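/- **Theorem (Complexity of is-bin-dag).** Consider the GP 2 program $$\texttt{Main = (init; Reduce!; Guard)!; Check}$$ with `Reduce = up!; try Delete else set_flag`, `Delete = {del1, del1_d, del21, del21_d, del22, del22_d, del0}`, `Guard = if flag then break`, `Check = if flag then fail`, where the rules are as follows. All labels are list variables; nodes are unrooted and edges are unmarked unless stated otherwise; distinct items of a left-hand side match distinct items, and matches preserve and reflect roots; a node may be deleted only if all its incident edges are deleted with it (dangling condition). - `init`: a grey unrooted node becomes a root. - `up`: a grey root $u$ with an unmarked incoming edge from a grey unrooted node $v$, where $\mathrm{outdeg}(u)<3$: the edge becomes dashed, $u$ becomes unrooted and $v$ becomes the root. - `del1`, `del1_d`: a grey root $u$ with an edge to a grey node $v$ (unmarked in `del1`, dashed in `del1_d`): $u$ and the edge are deleted and $v$ becomes the root. - `del21`, `del21_d`: a grey root $u$ with two parallel edges to a grey node $v$ (both unmarked in `del21`, one dashed and one unmarked in `del21_d`): $u$ and both edges are deleted and $v$ becomes the root. - `del22`, `del22_d`: a grey root $u$ with edges $a$ to $v$ and $b$ to $w$, where $v\ne w$ are grey nodes, $b$ is unmarked, and $a$ is unmarked in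 `del22` and dashed in `del22_d`: $u$, $a$, $b$ are deleted and $v$ becomes the root. - `del0`: a grey root without incident edges is deleted. - `set_flag`: a grey root becomes an unmarked root. - `flag`: matches an unmarked root and leaves the graph unchanged. An *input graph* is a finite directed graph (parallel edges and loops allowed, no bound on the node degrees) with arbitrary labels in which every node is grey and unrooted and every edge is unmarked. Its *size* is the number of its nodes plus the number of its edges. Running time is counted in elementary operations of the compiled program. The host graph is stored with lists of all nodes, of all root nodes, and of the incoming and the outgoing edges of each node, in arbitrary order. A rule is matched by backtracking along a search plan that starts at the left-hand root (for `init`: at the list of all nodes) and proceeds along outgoing edges of that root (for `up`: incoming edges). Fetching a first or next list item (or noticing the end of a list), together with the constant-time checks on that item (marks, rootedness, degrees and application condition, whether it is in use), takes one time unit; applying a rule at a match that has been found takes constant time, and so does every control transfer. A rule set tries its rules one after the other, in any order. Undoing the changes of a subcomputation that a command discards costs at most the time of that subcomputation. Loading the input graph and writing the result graph take time equal to their sizes. Then `is-bin-dag` terminates in linear time on arbitrary input graphs: there is a constant $C$ such that for every input graph $G$, no execution of `Main` on $G$ diverges or gets stuck, and every execution takes total time at most $C\cdot(\mathrm{size}(G)+1)$.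 -/

import Mathlib

namespace GP2

/-! ### Host graphs -/

/-- Labels of host graphs: lists of integers and character strings. -/
abbrev Label := List (ℤ ⊕ String)

inductive NodeMark
  | unmarked | grey | red | green | blue
  deriving DecidableEq

inductive EdgeMark
  | unmarked | dashed | red | green | blue
  deriving DecidableEq

/-- Finite directed graphs with parallel edges and loops; nodes and edges carry a label and a mark,
and some of the nodes are roots. The values of the functions outside `V` and `E` are irrelevant. -/
structure HostGraph where
  V : Finset ℕ
  E : Finset ℕ
  src : ℕ → ℕ
  tgt : ℕ → ℕ
  src_mem : ∀ e ∈ E, src e ∈ V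
  tgt_mem : ∀ e ∈ E, tgt e ∈ V
  nodeLabel : ℕ → Label
  edgeLabel : ℕ → Label
  nodeMark : ℕ → NodeMark
  edgeMark : ℕ → EdgeMark
  root : ℕ → Bool

/-- The number of nodes and edges. -/
def HostGraph.size (G : HostGraph) : ℕ := G.V.card + G.E.card

def HostGraph.inEdges (G : HostGraph) (v : ℕ) : Finset ℕ := {e ∈ G.E | G.tgt e = v}

def HostGraph.outEdges (G : HostGraph) (v : ℕ) : Finset ℕ := {e ∈ G.E | G.src e = v}

def HostGraph.indeg (G : HostGraph) (v : ℕ) : ℕ := (G.inEdges v).card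

def HostGraph.outdeg (G : HostGraph) (v : ℕ) : ℕ := (G.outEdges v).card

/-- Input graphs: arbitrarily labelled, all nodes grey and unrooted, all edges unmarked. -/
structure HostGraph.IsInput (G : HostGraph) : Prop where
  grey : ∀ v ∈ G.V, G.nodeMark v = NodeMark.grey
  unrooted : ∀ v ∈ G.V, G.root v = false
  unmarked : ∀ e ∈ G.E, G.edgeMark e = EdgeMark.unmarked

/-! ### Rules -/

/-- Variables of type `list`. -/
inductive Var
  | a | b | x | y | z
  deriving DecidableEq

structure RuleNode where
  var : Var
  mark : NodeMark
  root : Bool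

structure RuleEdge (n : ℕ) where
  src : Fin n
  tgt : Fin n
  var : Var
  mark : EdgeMark

/-- The graphs in a rule, with `n` nodes and `k` edges, each labelled by a list variable. -/
structure RuleGraph where
  n : ℕ
  k : ℕ
  node : Fin n → RuleNode
  edge : Fin k → RuleEdge n

def RuleGraph.indeg (L : RuleGraph) (i : Fin L.n) : ℕ :=
  (Finset.univ.filter fun e => (L.edge e).tgt = i).card

def RuleGraph.outdeg (L : RuleGraph) (i : Fin L.n) : ℕ :=
  (Finset.univ.filter fun e => (L.edge e).src = i).card

/-- The variable that labels a node or an edge. -/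
def RuleGraph.var (L : RuleGraph) : Fin L.n ⊕ Fin L.k → Var :=
  Sum.elim (fun i => (L.node i).var) (fun e => (L.edge e).var)

/-- The instructions of a search plan for a left-hand graph: look for node `i` among the host
graph's roots; look for node `i` among all nodes; look for edge `e` (and its other end point)
among the outgoing edges of its already matched source; the same among the incoming edges of its
already matched target. -/
inductive Instr (L : RuleGraph)
  | rootNode (i : Fin L.n)
  | anyNode (i : Fin L.n)
  | outEdge (e : Fin L.k)
  | inEdge (e : Fin L.k)

/-- `PlanOK L N M p`: if exactly the nodes in `N` and the edges in `M` are matched already, then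
the plan `p` matches every remaining node and edge of `L`, once each, and starts every edge search
at a node that is matched by then. -/
def PlanOK (L : RuleGraph) : Finset (Fin L.n) → Finset (Fin L.k) → List (Instr L) → Prop
  | N, M, [] => (∀ i, i ∈ N) ∧ ∀ e, e ∈ M
  | N, M, .rootNode i :: p => i ∉ N ∧ (L.node i).root = true ∧ PlanOK L (insert i N) M p
  | N, M, .anyNode i :: p => i ∉ N ∧ PlanOK L (insert i N) M p
  | N, M, .outEdge e :: p =>
      e ∉ M ∧ (L.edge e).src ∈ N ∧ PlanOK L (insert (L.edge e).tgt N) (insert e M) p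
  | N, M, .inEdge e :: p =>
      e ∉ M ∧ (L.edge e).tgt ∈ N ∧ PlanOK L (insert (L.edge e).src N) (insert e M) p

instance PlanOK.decidable (L : RuleGraph) : ∀ (N : Finset (Fin L.n)) (M : Finset (Fin L.k))
    (p : List (Instr L)), Decidable (PlanOK L N M p)
  | N, M, [] => inferInstanceAs (Decidable ((∀ i, i ∈ N) ∧ ∀ e, e ∈ M))
  | N, M, .rootNode i :: p =>
      have := PlanOK.decidable L (insert i N) M p
      inferInstanceAs (Decidable (i ∉ N ∧ (L.node i).root = true ∧ PlanOK L (insert i N) M p))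
  | N, M, .anyNode i :: p =>
      have := PlanOK.decidable L (insert i N) M p
      inferInstanceAs (Decidable (i ∉ N ∧ PlanOK L (insert i N) M p))
  | N, M, .outEdge e :: p =>
      have := PlanOK.decidable L (insert (L.edge e).tgt N) (insert e M) p
      inferInstanceAs (Decidable
        (e ∉ M ∧ (L.edge e).src ∈ N ∧ PlanOK L (insert (L.edge e).tgt N) (insert e M) p))
  | N, M, .inEdge e :: p =>
      have := PlanOK.decidable L (insert (L.edge e).src N) (insert e M) p
      inferInstanceAs (Decidable
        (e ∉ M ∧ (L.edge e).tgt ∈ N ∧ PlanOK L (insert (L.edge e).src N) (insert e M) p))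

/-- Conditional rules whose labels are list variables, without repeated variables on the left.
* `keep j = some i` says that node `j` of `R` and node `i` of `L` carry the same number; the nodes
  of `L` not in the range of `keep` are unnumbered and get deleted, those of `R` with
  `keep j = none` get created.
* `outdegLT i = some d` stands for the application condition `outdeg(i) < d`.
* `plan` is the search plan of the rule; it does not affect which matches exist. -/
structure Rule where
  L : RuleGraph
  R : RuleGraph
  keep : Fin R.n → Option (Fin L.n)
  keep_inj : ∀ j j' : Fin R.n, keep j ≠ none → keep j = keep j' → j = j'
  linear : Function.Injective L.var
  rhs_vars : ∀ s, ∃ s', L.var s' = R.var s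
  outdegLT : Fin L.n → Option ℕ
  plan : List (Instr L)
  plan_ok : PlanOK L ∅ ∅ plan

/-- The unnumbered nodes of the left-hand graph. -/
def Rule.Deleted (r : Rule) (i : Fin r.L.n) : Prop := ∀ j, r.keep j ≠ some i

instance (r : Rule) (i : Fin r.L.n) : Decidable (r.Deleted i) :=
  inferInstanceAs (Decidable (∀ j, r.keep j ≠ some i))

/-- `f` and `g` map the left-hand graph, with the variables replaced according to `α`, injectively
to a subgraph of `G`, preserving marks and preserving and reflecting roots, such that the
application condition and the dangling condition hold. -/
structure Rule.IsMatch (r : Rule) (G : HostGraph) (f : Fin r.L.n → ℕ) (g : Fin r.L.k → ℕ)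
    (α : Var → Label) : Prop where
  node_inj : Function.Injective f
  edge_inj : Function.Injective g
  node_mem : ∀ i, f i ∈ G.V
  edge_mem : ∀ e, g e ∈ G.E
  src : ∀ e, G.src (g e) = f (r.L.edge e).src
  tgt : ∀ e, G.tgt (g e) = f (r.L.edge e).tgt
  node_label : ∀ i, G.nodeLabel (f i) = α (r.L.node i).var
  edge_label : ∀ e, G.edgeLabel (g e) = α (r.L.edge e).var
  node_mark : ∀ i, G.nodeMark (f i) = (r.L.node i).mark
  edge_mark : ∀ e, G.edgeMark (g e) = (r.L.edge e).mark
  root : ∀ i, G.root (f i) = (r.L.node i).root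
  condition : ∀ i, ∀ d ∈ r.outdegLT i, G.outdeg (f i) < d
  dangling : ∀ i, r.Deleted i → ∀ c ∈ G.E, G.src c = f i ∨ G.tgt c = f i → ∃ e, g e = c

/-- `H` arises from `G` by replacing the match `f`, `g` with the instantiated right-hand graph,
which `f'` and `g'` embed into `H`: numbered nodes stay in place, all other nodes and all edges of
the match are removed, and the remaining nodes and all edges of the right-hand graph are added
under fresh names. -/
structure Rule.IsResult (r : Rule) (G : HostGraph) (f : Fin r.L.n → ℕ) (g : Fin r.L.k → ℕ)
    (α : Var → Label) (f' : Fin r.R.n → ℕ) (g' : Fin r.R.k → ℕ) (H : HostGraph) : Prop where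
  node_inj : Function.Injective f'
  edge_inj : Function.Injective g'
  kept : ∀ j, ∀ i ∈ r.keep j, f' j = f i
  fresh_node : ∀ j, r.keep j = none → f' j ∈ G.V → ∃ i, r.Deleted i ∧ f i = f' j
  fresh_edge : ∀ e, g' e ∈ G.E → ∃ e', g e' = g' e
  nodes : ∀ v, v ∈ H.V ↔ (v ∈ G.V ∧ ¬ ∃ i, r.Deleted i ∧ f i = v) ∨ ∃ j, f' j = v
  edges : ∀ c, c ∈ H.E ↔ (c ∈ G.E ∧ ¬ ∃ e, g e = c) ∨ ∃ e, g' e = c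
  old_node : ∀ v ∈ G.V, (¬ ∃ i, f i = v) → H.nodeLabel v = G.nodeLabel v ∧
    H.nodeMark v = G.nodeMark v ∧ H.root v = G.root v
  old_edge : ∀ c ∈ G.E, (¬ ∃ e, g e = c) → H.src c = G.src c ∧ H.tgt c = G.tgt c ∧
    H.edgeLabel c = G.edgeLabel c ∧ H.edgeMark c = G.edgeMark c
  new_node : ∀ j, H.nodeLabel (f' j) = α (r.R.node j).var ∧
    H.nodeMark (f' j) = (r.R.node j).mark ∧ H.root (f' j) = (r.R.node j).root
  new_edge : ∀ e, H.src (g' e) = f' (r.R.edge e).src ∧ H.tgt (g' e) = f' (r.R.edge e).tgt ∧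
    H.edgeLabel (g' e) = α (r.R.edge e).var ∧ H.edgeMark (g' e) = (r.R.edge e).mark

/-- `H` results from `G` by an application of `r`. -/
def Rule.Applies (r : Rule) (G H : HostGraph) : Prop :=
  ∃ f g α f' g', r.IsMatch G f g α ∧ r.IsResult G f g α f' g' H

/-! ### The matching algorithm and its running time -/

/-- The lists in which the run-time system stores a host graph: all nodes, the roots, and the
outgoing and incoming edges of each node, each in an arbitrary order. -/
structure HostGraph.Lists (G : HostGraph) where
  nodes : List ℕ
  roots : List ℕ
  outE : ℕ → List ℕ
  inE : ℕ → List ℕ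
  nodup_nodes : nodes.Nodup
  nodup_roots : roots.Nodup
  nodup_outE : ∀ v, (outE v).Nodup
  nodup_inE : ∀ v, (inE v).Nodup
  mem_nodes : ∀ v, v ∈ nodes ↔ v ∈ G.V
  mem_roots : ∀ v, v ∈ roots ↔ v ∈ G.V ∧ G.root v = true
  mem_outE : ∀ v c, c ∈ outE v ↔ c ∈ G.outEdges v
  mem_inE : ∀ v c, c ∈ inE v ↔ c ∈ G.inEdges v

/-- A partial assignment of host graph items to the items of a left-hand graph. -/
@[ext] structure Partial (L : RuleGraph) where
  node : Fin L.n → Option ℕ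
  edge : Fin L.k → Option ℕ

def Partial.empty (L : RuleGraph) : Partial L := ⟨fun _ => none, fun _ => none⟩

/-- The checks that `v` is a candidate for node `i`: mark, rootedness, application condition, and
degrees. The degrees of `v` must be at least those of `i`, and equal to them if `i` is to be
deleted. -/
def Rule.NodeOK (r : Rule) (G : HostGraph) (i : Fin r.L.n) (v : ℕ) : Prop :=
  G.nodeMark v = (r.L.node i).mark ∧ G.root v = (r.L.node i).root ∧
  (∀ d ∈ r.outdegLT i, G.outdeg v < d) ∧
  r.L.indeg i ≤ G.indeg v ∧ r.L.outdeg i ≤ G.outdeg v ∧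
  (r.Deleted i → G.indeg v = r.L.indeg i ∧ G.outdeg v = r.L.outdeg i)

instance (r : Rule) (G : HostGraph) (i : Fin r.L.n) (v : ℕ) : Decidable (r.NodeOK G i v) := by
  unfold Rule.NodeOK; infer_instance

/-- Try `v` for node `i`: if `i` is matched already then `v` has to be its image, otherwise `v`
must not be in use and has to pass the checks. -/
def Rule.bindNode (r : Rule) (G : HostGraph) (i : Fin r.L.n) (v : ℕ) (m : Partial r.L) :
    Option (Partial r.L) :=
  match m.node i with
  | some w => if w = v then some m else none
  | none =>
    if (∀ j, m.node j ≠ some v) ∧ r.NodeOK G i v then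
      some { m with node := Function.update m.node i (some v) }
    else none

/-- Try `c` for edge `e`, whose end point `i` is to be matched with `v`. -/
def Rule.bindEdge (r : Rule) (G : HostGraph) (e : Fin r.L.k) (c : ℕ) (i : Fin r.L.n) (v : ℕ)
    (m : Partial r.L) : Option (Partial r.L) :=
  if (∀ e', m.edge e' ≠ some c) ∧ G.edgeMark c = (r.L.edge e).mark then
    r.bindNode G i v { m with edge := Function.update m.edge e (some c) }
  else none

/-- The list that an instruction runs through. -/
def Instr.candidates {L : RuleGraph} {G : HostGraph} (D : G.Lists) (m : Partial L) :
    Instr L → List ℕ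
  | .rootNode _ => D.roots
  | .anyNode _ => D.nodes
  | .outEdge e => ((m.node (L.edge e).src).map D.outE).getD []
  | .inEdge e => ((m.node (L.edge e).tgt).map D.inE).getD []

/-- Try one candidate of an instruction. -/
def Rule.extend (r : Rule) (G : HostGraph) (m : Partial r.L) (c : ℕ) :
    Instr r.L → Option (Partial r.L)
  | .rootNode i => r.bindNode G i c m
  | .anyNode i => r.bindNode G i c m
  | .outEdge e => r.bindEdge G e c (r.L.edge e).tgt (G.tgt c) m
  | .inEdge e => r.bindEdge G e c (r.L.edge e).src (G.src c) m

/-- Run through a list until `k` succeeds on a candidate. One time unit is charged for each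
candidate that is fetched (together with the fixed number of constant-time checks on it) and for
noticing the end of the list, in addition to the time that `k` takes. -/
def firstSuccess {β : Type} (k : ℕ → Option β × ℕ) : List ℕ → Option β × ℕ
  | [] => (none, 1)
  | c :: cs =>
    match k c with
    | (some b, t) => (some b, t + 1)
    | (none, t) => ((firstSuccess k cs).1, t + 1 + (firstSuccess k cs).2)

/-- Backtracking search along a search plan: the result and the time it takes. -/
def Rule.search (r : Rule) (G : HostGraph) (D : G.Lists) :
    List (Instr r.L) → Partial r.L → Option (Partial r.L) × ℕ
  | [], m => (some m, 0)
  | s :: p, m =>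
    firstSuccess
      (fun c =>
        match r.extend G m c s with
        | none => (none, 0)
        | some m' => r.search G D p m')
      (s.candidates D m)

/-- The matching algorithm of a rule. -/
def Rule.findMatch (r : Rule) (G : HostGraph) (D : G.Lists) : Option (Partial r.L) × ℕ :=
  r.search G D r.plan (Partial.empty r.L)

/-- The number of elementary modifications when a rule is applied at a given match. -/
def Rule.applyTime (r : Rule) : ℕ := r.L.n + r.L.k + r.R.n + r.R.k

/-- Applying `r` to `G` may take time `t` and succeed with result `H`. -/
def Rule.Succeeds (r : Rule) (G : HostGraph) (t : ℕ) (H : HostGraph) : Prop :=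
  ∃ (D : G.Lists) (f : Fin r.L.n → ℕ) (g : Fin r.L.k → ℕ) (s : ℕ),
    r.findMatch G D = (some ⟨fun i => some (f i), fun e => some (g e)⟩, s) ∧
    t = s + r.applyTime ∧
    ∃ α f' g', r.IsMatch G f g α ∧ r.IsResult G f g α f' g' H

/-- Applying `r` to `G` may take time `t` and fail. -/
def Rule.Fails (r : Rule) (G : HostGraph) (t : ℕ) : Prop :=
  ∃ D : G.Lists, r.findMatch G D = (none, t)

/-- Try the rules of a list one after the other until one succeeds. The outcome is the resulting
graph, or `none` if all rules fail; the number is the total time. -/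
inductive TryRules (G : HostGraph) : List Rule → ℕ → Option HostGraph → Prop
  | nil : TryRules G [] 0 none
  | hit {r rs t H} : r.Succeeds G t H → TryRules G (r :: rs) t (some H)
  | miss {r rs t t' o} : r.Fails G t → TryRules G rs t' o → TryRules G (r :: rs) (t + t') o

/-- The call of a rule set: the rules are tried in an arbitrary order. Apart from the time, this is
the application of one of the rules, and failure if no rule is applicable; see `call_some_iff` and
`call_none_iff`. -/
def Call (R : List Rule) (G : HostGraph) (t : ℕ) (o : Option HostGraph) : Prop :=
  ∃ rs : List Rule, rs.Perm R ∧ TryRules G rs t o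

/-! ### Programs and their timed operational semantics -/

/-- Command sequences (procedures are macros). -/
inductive Com
  | call (R : List Rule)
  | seq (P Q : Com)
  | ifElse (C P Q : Com)
  | tryElse (C P Q : Com)
  | alap (P : Com)
  | brk
  | skip
  | fail

/-- Configurations: an unfinished computation, a result graph, or failure. -/
inductive Config
  | run (P : Com) (G : HostGraph)
  | graph (G : HostGraph)
  | fail

mutual

/-- `Step P G t γ` is the small-step transition from `⟨P, G⟩` to `γ`, taking time `t`. A rule-set
call takes the time of its matching attempts and of the rule application, and every transition
takes at least one time unit. When a branching command or a loop discards the changes made by a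
subcomputation, undoing them is charged with the full time of that subcomputation. -/
inductive Step : Com → HostGraph → ℕ → Config → Prop
  | call1 {R G t H} : Call R G t (some H) → Step (.call R) G (t + 1) (.graph H)
  | call2 {R G t} : Call R G t none → Step (.call R) G (t + 1) .fail
  | seq1 {P Q P' G H t} : Step P G t (.run P' H) → Step (.seq P Q) G t (.run (.seq P' Q) H)
  | seq2 {P Q G H t} : Step P G t (.graph H) → Step (.seq P Q) G t (.run Q H)
  | seq3 {P Q G t} : Step P G t .fail → Step (.seq P Q) G t .fail
  | if1 {C P Q G H t} : Steps (.run C G) t (.graph H) →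
      Step (.ifElse C P Q) G (2 * t + 1) (.run P G)
  | if2 {C P Q G t} : Steps (.run C G) t .fail → Step (.ifElse C P Q) G (2 * t + 1) (.run Q G)
  | try1 {C P Q G H t} : Steps (.run C G) t (.graph H) →
      Step (.tryElse C P Q) G (t + 1) (.run P H)
  | try2 {C P Q G t} : Steps (.run C G) t .fail → Step (.tryElse C P Q) G (2 * t + 1) (.run Q G)
  | alap1 {P G H t} : Steps (.run P G) t (.graph H) → Step (.alap P) G (t + 1) (.run (.alap P) H)
  | alap2 {P G t} : Steps (.run P G) t .fail → Step (.alap P) G (2 * t + 1) (.graph G)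
  | alap3 {P G H t} : Steps (.run P G) t (.run .brk H) → Step (.alap P) G (t + 1) (.graph H)
  | brk {P G} : Step (.seq .brk P) G 1 (.run .brk G)
  | skip {G} : Step .skip G 1 (.graph G)
  | fail {G} : Step .fail G 1 .fail

/-- The reflexive-transitive closure of `Step`, adding up the times. (A graph or failure is never
reached from an unfinished computation in zero transitions.) -/
inductive Steps : Config → ℕ → Config → Prop
  | refl {γ} : Steps γ 0 γ
  | head {P G t t' γ δ} : Step P G t γ → Steps γ t' δ → Steps (.run P G) (t + t') δ

end

/-- `P` can diverge from `G`. -/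
def CanDiverge (P : Com) (G : HostGraph) : Prop :=
  ∃ s : ℕ → Com × HostGraph, s 0 = (P, G) ∧
    ∀ i, ∃ t, Step (s i).1 (s i).2 t (.run (s (i + 1)).1 (s (i + 1)).2)

/-- `P` can get stuck from `G`. -/
def CanGetStuck (P : Com) (G : HostGraph) : Prop :=
  ∃ t Q H, Steps (.run P G) t (.run Q H) ∧ ¬ ∃ t' γ, Step Q H t' γ

/-- `Elapsed P G t`: some execution of `P` on `G`, finished or not, can have used time `t` at one
of its transitions. Unlike `Steps`, this also sees unfinished executions of conditions of branching
commands and of loop bodies. -/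
inductive Elapsed : Com → HostGraph → ℕ → Prop
  | start {P G} : Elapsed P G 0
  | step {P G t P' G' t'} : Step P G t (.run P' G') → Elapsed P' G' t' → Elapsed P G (t + t')
  | done {P G t H} : Step P G t (.graph H) → Elapsed P G t
  | failed {P G t} : Step P G t .fail → Elapsed P G t
  | inSeq {P Q G t} : Elapsed P G t → Elapsed (.seq P Q) G t
  | inIf {C P Q G t} : Elapsed C G t → Elapsed (.ifElse C P Q) G t
  | inTry {C P Q G t} : Elapsed C G t → Elapsed (.tryElse C P Q) G t
  | inLoop {P G t} : Elapsed P G t → Elapsed (.alap P) G t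

/-- Every execution of `P` on `G` ends with a graph or failure, and takes time at most `b`. This
includes time `G.size` for loading `G`, and `H.size` for writing the result `H` if there is one. -/
structure TerminatesWithin (P : Com) (G : HostGraph) (b : ℕ) : Prop where
  not_diverge : ¬ CanDiverge P G
  not_stuck : ¬ CanGetStuck P G
  elapsed : ∀ t, Elapsed P G t → G.size + t ≤ b
  output : ∀ t H, Steps (.run P G) t (.graph H) → G.size + t + H.size ≤ b

/-! ### The program `is-bin-dag` -/

namespace IsBinDag

open Var

/-- Grey unrooted node, grey root, unmarked root; unmarked edge, dashed edge. -/
abbrev gN (v : Var) : RuleNode := ⟨v, .grey, false⟩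
abbrev gR (v : Var) : RuleNode := ⟨v, .grey, true⟩
abbrev wR (v : Var) : RuleNode := ⟨v, .unmarked, true⟩
abbrev uE {n : ℕ} (v : Var) (s t : Fin n) : RuleEdge n := ⟨s, t, v, .unmarked⟩
abbrev dE {n : ℕ} (v : Var) (s t : Fin n) : RuleEdge n := ⟨s, t, v, .dashed⟩

def init : Rule where
  L := ⟨1, 0, ![gN x], ![]⟩
  R := ⟨1, 0, ![gR x], ![]⟩
  keep := ![some 0]
  keep_inj := by decide
  linear := by decide
  rhs_vars := by decide
  outdegLT := ![none]
  plan := [.anyNode 0]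
  plan_ok := by decide

def up : Rule where
  L := ⟨2, 1, ![gR x, gN y], ![uE a 1 0]⟩
  R := ⟨2, 1, ![gN x, gR y], ![dE a 1 0]⟩
  keep := ![some 0, some 1]
  keep_inj := by decide
  linear := by decide
  rhs_vars := by decide
  outdegLT := ![some 3, none]
  plan := [.rootNode 0, .inEdge 0]
  plan_ok := by decide

def del1 : Rule where
  L := ⟨2, 1, ![gN x, gR y], ![uE a 1 0]⟩
  R := ⟨1, 0, ![gR x], ![]⟩
  keep := ![some 0]
  keep_inj := by decide
  linear := by decide
  rhs_vars := by decide
  outdegLT := ![none, none]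
  plan := [.rootNode 1, .outEdge 0]
  plan_ok := by decide

def del1_d : Rule where
  L := ⟨2, 1, ![gN x, gR y], ![dE a 1 0]⟩
  R := ⟨1, 0, ![gR x], ![]⟩
  keep := ![some 0]
  keep_inj := by decide
  linear := by decide
  rhs_vars := by decide
  outdegLT := ![none, none]
  plan := [.rootNode 1, .outEdge 0]
  plan_ok := by decide

def del21 : Rule where
  L := ⟨2, 2, ![gN x, gR y], ![uE a 1 0, uE b 1 0]⟩
  R := ⟨1, 0, ![gR x], ![]⟩
  keep := ![some 0]
  keep_inj := by decide
  linear := by decide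
  rhs_vars := by decide
  outdegLT := ![none, none]
  plan := [.rootNode 1, .outEdge 0, .outEdge 1]
  plan_ok := by decide

def del21_d : Rule where
  L := ⟨2, 2, ![gN x, gR y], ![dE a 1 0, uE b 1 0]⟩
  R := ⟨1, 0, ![gR x], ![]⟩
  keep := ![some 0]
  keep_inj := by decide
  linear := by decide
  rhs_vars := by decide
  outdegLT := ![none, none]
  plan := [.rootNode 1, .outEdge 0, .outEdge 1]
  plan_ok := by decide

def del22 : Rule where
  L := ⟨3, 2, ![gN x, gN y, gR z], ![uE a 2 0, uE b 2 1]⟩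
  R := ⟨2, 0, ![gR x, gN y], ![]⟩
  keep := ![some 0, some 1]
  keep_inj := by decide
  linear := by decide
  rhs_vars := by decide
  outdegLT := ![none, none, none]
  plan := [.rootNode 2, .outEdge 0, .outEdge 1]
  plan_ok := by decide

def del22_d : Rule where
  L := ⟨3, 2, ![gN x, gN y, gR z], ![dE a 2 0, uE b 2 1]⟩
  R := ⟨2, 0, ![gR x, gN y], ![]⟩
  keep := ![some 0, some 1]
  keep_inj := by decide
  linear := by decide
  rhs_vars := by decide
  outdegLT := ![none, none, none]
  plan := [.rootNode 2, .outEdge 0, .outEdge 1]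
  plan_ok := by decide

def del0 : Rule where
  L := ⟨1, 0, ![gR x], ![]⟩
  R := ⟨0, 0, ![], ![]⟩
  keep := ![]
  keep_inj := by decide
  linear := by decide
  rhs_vars := by decide
  outdegLT := ![none]
  plan := [.rootNode 0]
  plan_ok := by decide

def set_flag : Rule where
  L := ⟨1, 0, ![gR x], ![]⟩
  R := ⟨1, 0, ![wR x], ![]⟩
  keep := ![some 0]
  keep_inj := by decide
  linear := by decide
  rhs_vars := by decide
  outdegLT := ![none]
  plan := [.rootNode 0]
  plan_ok := by decide

def flag : Rule where
  L := ⟨1, 0, ![wR x], ![]⟩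
  R := ⟨1, 0, ![wR x], ![]⟩
  keep := ![some 0]
  keep_inj := by decide
  linear := by decide
  rhs_vars := by decide
  outdegLT := ![none]
  plan := [.rootNode 0]
  plan_ok := by decide

/-- `Delete = {del1, del1_d, del21, del21_d, del22, del22_d, del0}` -/
def Delete : Com := .call [del1, del1_d, del21, del21_d, del22, del22_d, del0]

/-- `Reduce = up!; try Delete else set_flag` -/
def Reduce : Com := .seq (.alap (.call [up])) (.tryElse Delete .skip (.call [set_flag]))

/-- `Guard = if flag then break` -/
def Guard : Com := .ifElse (.call [flag]) .brk .skip

/-- `Check = if flag then fail` -/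
def Check : Com := .ifElse (.call [flag]) .fail .skip

/-- `Main = (init; Reduce!; Guard)!; Check` -/
def Main : Com := .seq (.alap (.seq (.call [init]) (.seq (.alap Reduce) Guard))) Check

end IsBinDag

/-! ### Rule calls agree with rule application -/

theorem firstSuccess_sound {β : Type} {k : ℕ → Option β × ℕ} {l : List ℕ} {b : β}
    (h : (firstSuccess k l).1 = some b) : ∃ c ∈ l, (k c).1 = some b := by
  induction l with
  | nil => simp [firstSuccess] at h
  | cons c cs ih =>
    unfold firstSuccess at h
    split at h
    · rename_i b' t hk
      exact ⟨c, by simp, by simp_all⟩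
    · obtain ⟨c', hc', hb⟩ := ih h
      exact ⟨c', by simp [hc'], hb⟩

theorem firstSuccess_none {β : Type} {k : ℕ → Option β × ℕ} {l : List ℕ}
    (h : (firstSuccess k l).1 = none) : ∀ c ∈ l, (k c).1 = none := by
  induction l with
  | nil => simp
  | cons c cs ih =>
    unfold firstSuccess at h
    split at h
    · simp at h
    · rename_i t hk
      intro c' hc'
      rcases List.mem_cons.1 hc' with rfl | hc'
      · simp [hk]
      · exact ih h c' hc'

theorem Rule.bindNode_some {r : Rule} {G : HostGraph} {i : Fin r.L.n} {v : ℕ}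
    {m m' : Partial r.L} (h : r.bindNode G i v m = some m') :
    m'.edge = m.edge ∧ m'.node = Function.update m.node i (some v) ∧
      (m.node i = some v ∨ (m.node i = none ∧ (∀ j, m.node j ≠ some v) ∧ r.NodeOK G i v)) := by
  unfold Rule.bindNode at h
  split at h
  · rename_i w hw
    split at h
    · rename_i hv
      subst hv
      cases h
      refine ⟨rfl, ?_, Or.inl hw⟩
      rw [← hw, Function.update_eq_self]
    · simp at h
  · rename_i hw
    split at h
    · rename_i hv
      cases h
      exact ⟨rfl, rfl, Or.inr ⟨hw, hv⟩⟩
    · simp at h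

/-- The invariant of the search. -/
structure Rule.Good (r : Rule) (G : HostGraph) (N : Finset (Fin r.L.n)) (M : Finset (Fin r.L.k))
    (m : Partial r.L) : Prop where
  dom_node : ∀ i, i ∈ N ↔ ∃ v, m.node i = some v
  dom_edge : ∀ e, e ∈ M ↔ ∃ c, m.edge e = some c
  node_ok : ∀ i v, m.node i = some v → v ∈ G.V ∧ r.NodeOK G i v
  node_inj : ∀ i j v, m.node i = some v → m.node j = some v → i = j
  edge_ok : ∀ e c, m.edge e = some c → c ∈ G.E ∧ G.edgeMark c = (r.L.edge e).mark ∧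
    m.node (r.L.edge e).src = some (G.src c) ∧ m.node (r.L.edge e).tgt = some (G.tgt c)
  edge_inj : ∀ e e' c, m.edge e = some c → m.edge e' = some c → e = e'

theorem Rule.Good.bindNode {r : Rule} {G : HostGraph} {N M} {i : Fin r.L.n} {v : ℕ}
    {m m' : Partial r.L} (hm : r.Good G N M m) (hv : v ∈ G.V)
    (h : r.bindNode G i v m = some m') : r.Good G (insert i N) M m' := by
  obtain ⟨h1, h2, h3⟩ := Rule.bindNode_some h
  have key : ∀ j w, m'.node j = some w → (j = i ∧ w = v) ∨ (j ≠ i ∧ m.node j = some w) := by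
    intro j w hj
    rw [h2, Function.update_apply] at hj
    split at hj
    · left; simp_all
    · right; simp_all
  have mono : ∀ j w, m.node j = some w → m'.node j = some w := by
    intro j w hj
    rw [h2, Function.update_apply]
    split
    · rename_i hji; subst hji
      rcases h3 with h3 | h3
      · rw [← hj, h3]
      · rw [h3.1] at hj; simp at hj
    · exact hj
  refine ⟨?_, ?_, ?_, ?_, ?_, ?_⟩
  · intro j
    rw [Finset.mem_insert, hm.dom_node, h2, Function.update_apply]
    by_cases hj : j = i <;> simp [hj]
  · intro e; rw [h1]; exact hm.dom_edge e
  · intro j w hj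
    rcases key j w hj with ⟨rfl, rfl⟩ | ⟨_, hj⟩
    · rcases h3 with h3 | h3
      · exact hm.node_ok _ _ h3
      · exact ⟨hv, h3.2.2⟩
    · exact hm.node_ok _ _ hj
  · intro j j' w hj hj'
    rcases key j w hj with ⟨rfl, rfl⟩ | ⟨hji, hj1⟩ <;>
      rcases key j' w hj' with ⟨rfl, hw⟩ | ⟨hji', hj1'⟩
    · rfl
    · rcases h3 with h3 | h3
      · exact hm.node_inj _ _ _ h3 hj1'
      · exact absurd hj1' (h3.2.1 _)
    · subst hw
      rcases h3 with h3 | h3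
      · exact hm.node_inj _ _ _ hj1 h3
      · exact absurd hj1 (h3.2.1 _)
    · exact hm.node_inj _ _ _ hj1 hj1'
  · intro e c he
    rw [h1] at he
    obtain ⟨a1, a2, a3, a4⟩ := hm.edge_ok e c he
    exact ⟨a1, a2, mono _ _ a3, mono _ _ a4⟩
  · intro e e' c; rw [h1]; exact hm.edge_inj e e' c

theorem Rule.Good.bindEdge {r : Rule} {G : HostGraph} {N M} {e : Fin r.L.k} {c : ℕ}
    {i b : Fin r.L.n} {v w : ℕ} {m m' : Partial r.L} (hm : r.Good G N M m) (hc : c ∈ G.E)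
    (hb : m.node b = some w)
    (hends : (i = (r.L.edge e).tgt ∧ v = G.tgt c ∧ b = (r.L.edge e).src ∧ w = G.src c) ∨
      (i = (r.L.edge e).src ∧ v = G.src c ∧ b = (r.L.edge e).tgt ∧ w = G.tgt c))
    (he : e ∉ M) (h : r.bindEdge G e c i v m = some m') :
    r.Good G (insert i N) (insert e M) m' := by
  unfold Rule.bindEdge at h
  split at h
  swap
  · simp at h
  rename_i hcc
  have hv : v ∈ G.V := by
    rcases hends with ⟨_, rfl, _⟩ | ⟨_, rfl, _⟩
    · exact G.tgt_mem c hc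
    · exact G.src_mem c hc
  have hme : m.edge e = none := by
    cases hx : m.edge e with
    | none => rfl
    | some x => exact absurd ((hm.dom_edge e).2 ⟨x, hx⟩) he
  -- first bind the node, then the edge
  have h' : r.bindNode G i v m = some ⟨m'.node, m.edge⟩ := by
    obtain ⟨h1, h2, h3⟩ := Rule.bindNode_some h
    dsimp only at h2 h3
    unfold Rule.bindNode
    rcases h3 with h3 | ⟨h3, h4⟩
    · rw [h3]
      simp only [if_true]
      rw [h2, ← h3, Function.update_eq_self]
    · rw [h3]
      simp only
      rw [if_pos h4, h2]
  have hg := hm.bindNode hv h'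
  obtain ⟨h1, h2, h3⟩ := Rule.bindNode_some h
  dsimp only at h1 h2 h3
  have hi : m'.node i = some v := by rw [h2]; simp
  have hb' : m'.node b = some w := by
    rw [h2, Function.update_apply]
    split
    · rename_i hbi; subst hbi
      rcases h3 with h3 | h3
      · rw [← hb, h3]
      · rw [h3.1] at hb; simp at hb
    · exact hb
  have key : ∀ e' c', m'.edge e' = some c' →
      (e' = e ∧ c' = c) ∨ (e' ≠ e ∧ m.edge e' = some c') := by
    intro j w hj
    rw [h1, Function.update_apply] at hj
    split at hj
    · left; simp_all
    · right; simp_all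
  refine ⟨hg.dom_node, ?_, hg.node_ok, hg.node_inj, ?_, ?_⟩
  · intro j
    rw [Finset.mem_insert, hm.dom_edge, h1, Function.update_apply]
    by_cases hj : j = e <;> simp [hj]
  · intro e' c' he'
    rcases key e' c' he' with ⟨rfl, rfl⟩ | ⟨_, he'⟩
    · refine ⟨hc, hcc.2, ?_⟩
      rcases hends with ⟨rfl, rfl, rfl, rfl⟩ | ⟨rfl, rfl, rfl, rfl⟩
      · exact ⟨hb', hi⟩
      · exact ⟨hi, hb'⟩
    · exact hg.edge_ok _ _ he'
  · intro e1 e2 c' he1 he2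
    rcases key e1 c' he1 with ⟨rfl, rfl⟩ | ⟨_, k1⟩ <;>
      rcases key e2 c' he2 with ⟨rfl, hw⟩ | ⟨_, k2⟩
    · rfl
    · exact absurd k2 (hcc.1 _)
    · subst hw; exact absurd k1 (hcc.1 _)
    · exact hm.edge_inj _ _ _ k1 k2

/-- A successful search matches all nodes and edges and keeps the invariant. -/
theorem Rule.Good.search {r : Rule} {G : HostGraph} {D : G.Lists} {p : List (Instr r.L)} :
    ∀ {N M} {m m' : Partial r.L}, r.Good G N M m → PlanOK r.L N M p →
      (r.search G D p m).1 = some m' → r.Good G Finset.univ Finset.univ m' := by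
  induction p with
  | nil =>
    intro N M m m' hm hp h
    simp only [Rule.search, Option.some.injEq] at h
    subst h
    obtain ⟨h1, h2⟩ := hp
    rwa [Finset.eq_univ_of_forall h1, Finset.eq_univ_of_forall h2] at hm
  | cons s p ih =>
    intro N M m m' hm hp h
    rw [Rule.search] at h
    obtain ⟨c, hc, hk⟩ := firstSuccess_sound h
    split at hk
    · simp at hk
    rename_i m1 hm1
    cases s with
    | rootNode i =>
      obtain ⟨hp1, -, hp2⟩ := hp
      exact ih (hm.bindNode ((D.mem_roots c).1 hc).1 hm1) hp2 hk
    | anyNode i =>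
      obtain ⟨hp1, hp2⟩ := hp
      exact ih (hm.bindNode ((D.mem_nodes c).1 hc) hm1) hp2 hk
    | outEdge e =>
      obtain ⟨hp1, hp2, hp3⟩ := hp
      obtain ⟨w, hw⟩ := (hm.dom_node _).1 hp2
      simp only [Instr.candidates, hw, Option.map_some, Option.getD_some, D.mem_outE,
        HostGraph.outEdges, Finset.mem_filter] at hc
      exact ih (hm.bindEdge hc.1 hw (Or.inl ⟨rfl, rfl, rfl, hc.2.symm⟩) hp1 hm1) hp3 hk
    | inEdge e =>
      obtain ⟨hp1, hp2, hp3⟩ := hp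
      obtain ⟨w, hw⟩ := (hm.dom_node _).1 hp2
      simp only [Instr.candidates, hw, Option.map_some, Option.getD_some, D.mem_inE,
        HostGraph.inEdges, Finset.mem_filter] at hc
      exact ih (hm.bindEdge hc.1 hw (Or.inr ⟨rfl, rfl, rfl, hc.2.symm⟩) hp1 hm1) hp3 hk

theorem Rule.good_empty (r : Rule) (G : HostGraph) : r.Good G ∅ ∅ (Partial.empty r.L) := by
  constructor <;> simp [Partial.empty]

/-- Whatever the matching algorithm finds is a match. -/
theorem Rule.findMatch_sound {r : Rule} {G : HostGraph} {D : G.Lists} {m : Partial r.L}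
    (h : (r.findMatch G D).1 = some m) :
    ∃ f g α, m = ⟨fun i => some (f i), fun e => some (g e)⟩ ∧ r.IsMatch G f g α := by
  have hm := (r.good_empty G).search r.plan_ok h
  have h1 := fun i => (hm.dom_node i).1 (Finset.mem_univ _)
  have h2 := fun e => (hm.dom_edge e).1 (Finset.mem_univ _)
  choose f hf using h1
  choose g hg using h2
  have hfi : Function.Injective f := fun i j hij => hm.node_inj i j (f i) (hf i) (by rw [hij, hf j])
  have hgi : Function.Injective g := fun i j hij => hm.edge_inj i j (g i) (hg i) (by rw [hij, hg j])
  have hsrc : ∀ e, G.src (g e) = f (r.L.edge e).src := fun e => by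
    have := (hm.edge_ok e _ (hg e)).2.2.1
    rw [hf] at this; exact (Option.some.inj this).symm
  have htgt : ∀ e, G.tgt (g e) = f (r.L.edge e).tgt := fun e => by
    have := (hm.edge_ok e _ (hg e)).2.2.2
    rw [hf] at this; exact (Option.some.inj this).symm
  have hEm : ∀ e, g e ∈ G.E := fun e => (hm.edge_ok e _ (hg e)).1
  let lab : Fin r.L.n ⊕ Fin r.L.k → Label :=
    Sum.elim (fun i => G.nodeLabel (f i)) (fun e => G.edgeLabel (g e))
  refine ⟨f, g, Function.extend r.L.var lab (fun _ => []), ?_, ?_⟩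
  · ext1
    · funext i; exact hf i
    · funext e; exact hg e
  · refine ⟨hfi, hgi, fun i => (hm.node_ok i _ (hf i)).1, hEm, hsrc, htgt,
      fun i => (r.linear.extend_apply lab (fun _ => []) (Sum.inl i)).symm,
      fun e => (r.linear.extend_apply lab (fun _ => []) (Sum.inr e)).symm,
      fun i => (hm.node_ok i _ (hf i)).2.1, fun e => (hm.edge_ok e _ (hg e)).2.1,
      fun i => (hm.node_ok i _ (hf i)).2.2.1, fun i => (hm.node_ok i _ (hf i)).2.2.2.1, ?_⟩
    intro i hi c hc hor
    obtain ⟨hin, hout⟩ := (hm.node_ok i _ (hf i)).2.2.2.2.2.2 hi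
    rcases hor with hs | ht
    · have hsub : (Finset.univ.filter fun e => (r.L.edge e).src = i).map ⟨g, hgi⟩ ⊆
          G.outEdges (f i) := by
        intro d hd
        simp only [Finset.mem_map, Finset.mem_filter, Finset.mem_univ, true_and,
          Function.Embedding.coeFn_mk] at hd
        obtain ⟨e, rfl, rfl⟩ := hd
        simp [HostGraph.outEdges, hEm, hsrc]
      have heq := Finset.eq_of_subset_of_card_le hsub (by
        rw [Finset.card_map]; exact hout.le)
      have : c ∈ G.outEdges (f i) := by simp [HostGraph.outEdges, hc, hs]
      rw [← heq] at this
      simp only [Finset.mem_map, Function.Embedding.coeFn_mk] at this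
      obtain ⟨e, -, he⟩ := this
      exact ⟨e, he⟩
    · have hsub : (Finset.univ.filter fun e => (r.L.edge e).tgt = i).map ⟨g, hgi⟩ ⊆
          G.inEdges (f i) := by
        intro d hd
        simp only [Finset.mem_map, Finset.mem_filter, Finset.mem_univ, true_and,
          Function.Embedding.coeFn_mk] at hd
        obtain ⟨e, rfl, rfl⟩ := hd
        simp [HostGraph.inEdges, hEm, htgt]
      have heq := Finset.eq_of_subset_of_card_le hsub (by
        rw [Finset.card_map]; exact hin.le)
      have : c ∈ G.inEdges (f i) := by simp [HostGraph.inEdges, hc, ht]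
      rw [← heq] at this
      simp only [Finset.mem_map, Function.Embedding.coeFn_mk] at this
      obtain ⟨e, -, he⟩ := this
      exact ⟨e, he⟩

theorem Rule.IsMatch.nodeOK {r : Rule} {G : HostGraph} {f g α} (h : r.IsMatch G f g α)
    (i : Fin r.L.n) : r.NodeOK G i (f i) := by
  have hin : ((Finset.univ.filter fun e => (r.L.edge e).tgt = i).map ⟨g, h.edge_inj⟩) ⊆
      G.inEdges (f i) := by
    intro d hd
    simp only [Finset.mem_map, Finset.mem_filter, Finset.mem_univ, true_and,
      Function.Embedding.coeFn_mk] at hd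
    obtain ⟨e, rfl, rfl⟩ := hd
    simp [HostGraph.inEdges, h.edge_mem, h.tgt]
  have hout : ((Finset.univ.filter fun e => (r.L.edge e).src = i).map ⟨g, h.edge_inj⟩) ⊆
      G.outEdges (f i) := by
    intro d hd
    simp only [Finset.mem_map, Finset.mem_filter, Finset.mem_univ, true_and,
      Function.Embedding.coeFn_mk] at hd
    obtain ⟨e, rfl, rfl⟩ := hd
    simp [HostGraph.outEdges, h.edge_mem, h.src]
  have cin : r.L.indeg i ≤ G.indeg (f i) := by
    have := Finset.card_le_card hin
    rwa [Finset.card_map] at this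
  have cout : r.L.outdeg i ≤ G.outdeg (f i) := by
    have := Finset.card_le_card hout
    rwa [Finset.card_map] at this
  refine ⟨h.node_mark i, h.root i, h.condition i, cin, cout, fun hi => ⟨?_, ?_⟩⟩
  · refine le_antisymm ?_ cin
    have : G.inEdges (f i) ⊆
        (Finset.univ.filter fun e => (r.L.edge e).tgt = i).map ⟨g, h.edge_inj⟩ := by
      intro c hc
      simp only [HostGraph.inEdges, Finset.mem_filter] at hc
      obtain ⟨e, rfl⟩ := h.dangling i hi c hc.1 (Or.inr hc.2)
      have := hc.2
      rw [h.tgt] at this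
      simpa using h.node_inj this
    have := Finset.card_le_card this
    rwa [Finset.card_map] at this
  · refine le_antisymm ?_ cout
    have : G.outEdges (f i) ⊆
        (Finset.univ.filter fun e => (r.L.edge e).src = i).map ⟨g, h.edge_inj⟩ := by
      intro c hc
      simp only [HostGraph.outEdges, Finset.mem_filter] at hc
      obtain ⟨e, rfl⟩ := h.dangling i hi c hc.1 (Or.inl hc.2)
      have := hc.2
      rw [h.src] at this
      simpa using h.node_inj this
    have := Finset.card_le_card this
    rwa [Finset.card_map] at this

/-- `m` agrees with the match `f`, `g`, and matches the nodes in `N` and the edges in `M`. -/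
structure Rule.Agree (r : Rule) (f : Fin r.L.n → ℕ) (g : Fin r.L.k → ℕ)
    (N : Finset (Fin r.L.n)) (M : Finset (Fin r.L.k)) (m : Partial r.L) : Prop where
  node : ∀ i, m.node i = if i ∈ N then some (f i) else none
  edge : ∀ e, m.edge e = if e ∈ M then some (g e) else none

theorem Rule.Agree.bindNode {r : Rule} {G : HostGraph} {f g α N M} {m : Partial r.L}
    (hm : r.Agree f g N M m) (h : r.IsMatch G f g α) (i : Fin r.L.n) :
    ∃ m', r.bindNode G i (f i) m = some m' ∧ r.Agree f g (insert i N) M m' := by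
  have hi := hm.node i
  unfold Rule.bindNode
  split_ifs at hi with hN
  · rw [hi]
    simp only [if_true]
    exact ⟨m, rfl, by rwa [Finset.insert_eq_of_mem hN]⟩
  · rw [hi]
    simp only
    rw [if_pos]
    · refine ⟨_, rfl, ?_, hm.edge⟩
      intro j
      simp only [Function.update_apply, Finset.mem_insert]
      by_cases hj : j = i
      · simp [hj]
      · simp [hj, hm.node j]
    · refine ⟨fun j hj => ?_, h.nodeOK i⟩
      rw [hm.node j] at hj
      split_ifs at hj with hjN
      have := h.node_inj (Option.some.inj hj)
      exact hN (this ▸ hjN)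

theorem Rule.Agree.bindEdge {r : Rule} {G : HostGraph} {f g α N M} {m : Partial r.L}
    (hm : r.Agree f g N M m) (h : r.IsMatch G f g α) (e : Fin r.L.k) (he : e ∉ M)
    (i : Fin r.L.n) :
    ∃ m', r.bindEdge G e (g e) i (f i) m = some m' ∧
      r.Agree f g (insert i N) (insert e M) m' := by
  unfold Rule.bindEdge
  rw [if_pos]
  · refine Rule.Agree.bindNode (M := insert e M)
      (m := ⟨m.node, Function.update m.edge e (some (g e))⟩) ⟨hm.node, ?_⟩ h i
    intro e'
    simp only [Function.update_apply, Finset.mem_insert]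
    by_cases hj : e' = e
    · simp [hj]
    · simp [hj, hm.edge e']
  · refine ⟨fun e' hj => ?_, h.edge_mark e⟩
    rw [hm.edge e'] at hj
    split_ifs at hj with hjM
    have := h.edge_inj (Option.some.inj hj)
    exact he (this ▸ hjM)

theorem Rule.Agree.search {r : Rule} {G : HostGraph} {D : G.Lists} {f g α}
    (h : r.IsMatch G f g α) {p : List (Instr r.L)} :
    ∀ {N M} {m : Partial r.L}, r.Agree f g N M m → PlanOK r.L N M p →
      (r.search G D p m).1 ≠ none := by
  induction p with
  | nil => intro N M m _ _; simp [Rule.search]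
  | cons s p ih =>
    intro N M m hm hp hn
    rw [Rule.search] at hn
    have hn := firstSuccess_none hn
    cases s with
    | rootNode i =>
      obtain ⟨-, hp1, hp2⟩ := hp
      obtain ⟨m', h1, h2⟩ := hm.bindNode h i
      have := hn (f i) ((D.mem_roots _).2 ⟨h.node_mem i, by rw [h.root, hp1]⟩)
      simp only [Rule.extend, h1] at this
      exact ih h2 hp2 this
    | anyNode i =>
      obtain ⟨-, hp2⟩ := hp
      obtain ⟨m', h1, h2⟩ := hm.bindNode h i
      have := hn (f i) ((D.mem_nodes _).2 (h.node_mem i))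
      simp only [Rule.extend, h1] at this
      exact ih h2 hp2 this
    | outEdge e =>
      obtain ⟨hp0, hp1, hp2⟩ := hp
      obtain ⟨m', h1, h2⟩ := hm.bindEdge h e hp0 (r.L.edge e).tgt
      have := hn (g e) (by
        simp [Instr.candidates, hm.node, hp1, D.mem_outE, HostGraph.outEdges, h.edge_mem, h.src])
      simp only [Rule.extend, h.tgt, h1] at this
      exact ih h2 hp2 this
    | inEdge e =>
      obtain ⟨hp0, hp1, hp2⟩ := hp
      obtain ⟨m', h1, h2⟩ := hm.bindEdge h e hp0 (r.L.edge e).src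
      have := hn (g e) (by
        simp [Instr.candidates, hm.node, hp1, D.mem_inE, HostGraph.inEdges, h.edge_mem, h.tgt])
      simp only [Rule.extend, h.src, h1] at this
      exact ih h2 hp2 this

/-- The matching algorithm fails exactly if there is no match. -/
theorem Rule.findMatch_eq_none_iff {r : Rule} {G : HostGraph} {D : G.Lists} :
    (r.findMatch G D).1 = none ↔ ¬ ∃ f g α, r.IsMatch G f g α := by
  constructor
  · rintro h ⟨f, g, α, hm⟩
    refine Rule.Agree.search hm (N := ∅) (M := ∅) (m := Partial.empty r.L) ⟨?_, ?_⟩ r.plan_ok h <;>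
      simp [Partial.empty]
  · intro h
    cases hm : (r.findMatch G D).1 with
    | none => rfl
    | some m =>
      obtain ⟨f, g, α, -, h'⟩ := Rule.findMatch_sound hm
      exact absurd ⟨f, g, α, h'⟩ h

theorem firstSuccess_append {β : Type} {k : ℕ → Option β × ℕ} {l l' : List ℕ} {c : ℕ} {b : β}
    (hl : ∀ d ∈ l, (k d).1 = none) (hc : (k c).1 = some b) :
    (firstSuccess k (l ++ c :: l')).1 = some b := by
  induction l with
  | nil =>
    rw [List.nil_append, firstSuccess]
    split <;> simp_all
  | cons d l ih =>
    rw [List.cons_append, firstSuccess]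
    have hd := hl d (by simp)
    split
    · simp_all
    · exact ih fun d' hd' => hl d' (by simp [hd'])

/-- The elements of `s`, those in `o` first and in the order of `o`. -/
noncomputable def sortBy (o : List ℕ) (s : Finset ℕ) : List ℕ :=
  s.toList.insertionSort fun c d => o.idxOf c ≤ o.idxOf d

theorem nodup_sortBy (o : List ℕ) (s : Finset ℕ) : (sortBy o s).Nodup :=
  (List.perm_insertionSort _ _).nodup_iff.2 s.nodup_toList

theorem mem_sortBy {o : List ℕ} {s : Finset ℕ} {c : ℕ} : c ∈ sortBy o s ↔ c ∈ s := by
  rw [sortBy, (List.perm_insertionSort _ _).mem_iff, Finset.mem_toList]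

theorem sortBy_split {o o' : List ℕ} {s : Finset ℕ} {c : ℕ} (hc : c ∈ s) (hco : c ∉ o) :
    ∃ l l', sortBy (o ++ c :: o') s = l ++ c :: l' ∧ ∀ d ∈ l, d ∈ o := by
  obtain ⟨l, l', h⟩ := List.append_of_mem (mem_sortBy (o := o ++ c :: o').2 hc)
  refine ⟨l, l', h, fun d hd => ?_⟩
  have hn := nodup_sortBy (o ++ c :: o') s
  have hs : List.Pairwise (fun a b => (o ++ c :: o').idxOf a ≤ (o ++ c :: o').idxOf b)
      (sortBy (o ++ c :: o') s) := by
    have : Std.Total fun a b => (o ++ c :: o').idxOf a ≤ (o ++ c :: o').idxOf b :=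
      ⟨fun a b => le_total _ _⟩
    have : IsTrans ℕ fun a b => (o ++ c :: o').idxOf a ≤ (o ++ c :: o').idxOf b :=
      ⟨fun a b c h h' => le_trans h h'⟩
    exact List.pairwise_insertionSort _ _
  rw [h] at hn hs
  have hle := (List.pairwise_append.1 hs).2.2 d hd c (by simp)
  have hne : d ≠ c := (List.nodup_append.1 hn).2.2 d hd c (by simp)
  by_contra hdo
  rw [List.idxOf_append_of_notMem hco, List.idxOf_append_of_notMem hdo,
    List.idxOf_cons_self, List.idxOf_cons_ne _ (Ne.symm hne)] at hle
  omega

/-- The lists of `G` in which given nodes and edges come first. -/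
noncomputable def HostGraph.listsBy (G : HostGraph) (o o' : List ℕ) : G.Lists where
  nodes := sortBy o G.V
  roots := sortBy o {v ∈ G.V | G.root v = true}
  outE v := sortBy o' (G.outEdges v)
  inE v := sortBy o' (G.inEdges v)
  nodup_nodes := nodup_sortBy _ _
  nodup_roots := nodup_sortBy _ _
  nodup_outE _ := nodup_sortBy _ _
  nodup_inE _ := nodup_sortBy _ _
  mem_nodes _ := mem_sortBy
  mem_roots _ := by simp [mem_sortBy]
  mem_outE _ _ := mem_sortBy
  mem_inE _ _ := mem_sortBy

/-- The node that an instruction matches, and its edge if there is one. -/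
def Instr.newNode {L : RuleGraph} : Instr L → Fin L.n
  | .rootNode i => i
  | .anyNode i => i
  | .outEdge e => (L.edge e).tgt
  | .inEdge e => (L.edge e).src

def Instr.newEdge {L : RuleGraph} : Instr L → List (Fin L.k)
  | .rootNode _ => []
  | .anyNode _ => []
  | .outEdge e => [e]
  | .inEdge e => [e]

theorem Rule.Agree.search_eq {r : Rule} {G : HostGraph} {f g α} (h : r.IsMatch G f g α) {N₀ M₀}
    (p : List (Instr r.L)) : ∀ {N M} {m : Partial r.L} (o o' : List ℕ),
      r.Agree f g N M m → PlanOK r.L N M p → (∀ v, v ∈ o ↔ ∃ i ∈ N, f i = v) →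
      (∀ c, c ∈ o' ↔ ∃ e ∈ M, g e = c) → N₀ = o ++ p.map (fun s => f s.newNode) →
      M₀ = o' ++ p.flatMap (fun s => s.newEdge.map g) →
      (r.search G (G.listsBy N₀ M₀) p m).1 =
        some ⟨fun i => some (f i), fun e => some (g e)⟩ := by
  induction p with
  | nil =>
    intro N M m o o' hm hp _ _ _ _
    obtain ⟨h1, h2⟩ := hp
    simp only [Rule.search, Option.some.injEq]
    ext1
    · funext i; rw [hm.node, if_pos (h1 i)]
    · funext e; rw [hm.edge, if_pos (h2 e)]
  | cons s p ih =>
    intro N M m o o' hm hp ho ho' hN hM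
    have usedN : ∀ d ∈ o, ∀ i ∉ N, r.bindNode G i d m = none := by
      intro d hd i hi
      obtain ⟨j, hj, rfl⟩ := (ho d).1 hd
      unfold Rule.bindNode
      rw [hm.node, if_neg hi]
      simp only
      rw [if_neg]
      rintro ⟨h1, -⟩
      exact h1 j (by rw [hm.node, if_pos hj])
    have usedM : ∀ d ∈ o', ∀ e i v, r.bindEdge G e d i v m = none := by
      intro d hd e i v
      obtain ⟨j, hj, rfl⟩ := (ho' d).1 hd
      unfold Rule.bindEdge
      rw [if_neg]
      rintro ⟨h1, -⟩
      exact h1 j (by rw [hm.edge, if_pos hj])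
    have insN : ∀ i v, v ∈ o ++ [f i] ↔ ∃ j ∈ insert i N, f j = v := by
      intro i v
      simp only [List.mem_append, ho, List.mem_singleton, Finset.mem_insert, exists_eq_or_imp]
      rw [or_comm, eq_comm]
    have insM : ∀ i v, v ∈ o' ++ [g i] ↔ ∃ j ∈ insert i M, g j = v := by
      intro i v
      simp only [List.mem_append, ho', List.mem_singleton, Finset.mem_insert, exists_eq_or_imp]
      rw [or_comm, eq_comm]
    have freshN : ∀ i ∉ N, f i ∉ o := fun i hi hx => by
      obtain ⟨j, hj, hji⟩ := (ho _).1 hx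
      exact hi (h.node_inj hji ▸ hj)
    have freshM : ∀ i ∉ M, g i ∉ o' := fun i hi hx => by
      obtain ⟨j, hj, hji⟩ := (ho' _).1 hx
      exact hi (h.edge_inj hji ▸ hj)
    rw [Rule.search]
    cases s with
    | rootNode i =>
      obtain ⟨hp0, hp1, hp2⟩ := hp
      obtain ⟨m', h1, h2⟩ := hm.bindNode h i
      replace hN : N₀ = o ++ f i :: p.map (fun s => f s.newNode) := hN
      replace hM : M₀ = o' ++ p.flatMap (fun s => s.newEdge.map g) := hM
      obtain ⟨l, l', hl, hlo⟩ := sortBy_split (o' := p.map fun s => f s.newNode)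
        (s := {v ∈ G.V | G.root v = true}) (c := f i)
        (by simp [h.node_mem, h.root, hp1]) (freshN i hp0)
      rw [← hN] at hl
      rw [show Instr.candidates (G.listsBy N₀ M₀) m (.rootNode i) = l ++ f i :: l' from hl]
      refine firstSuccess_append (fun d hd => ?_) ?_
      · simp only [Rule.extend, usedN d (hlo d hd) i hp0]
      · simp only [Rule.extend, h1]
        exact ih (o ++ [f i]) o' h2 hp2 (insN i) ho' (by rw [hN]; simp) hM
    | anyNode i =>
      obtain ⟨hp0, hp2⟩ := hp
      obtain ⟨m', h1, h2⟩ := hm.bindNode h i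
      replace hN : N₀ = o ++ f i :: p.map (fun s => f s.newNode) := hN
      replace hM : M₀ = o' ++ p.flatMap (fun s => s.newEdge.map g) := hM
      obtain ⟨l, l', hl, hlo⟩ := sortBy_split (o' := p.map fun s => f s.newNode)
        (s := G.V) (c := f i) (h.node_mem i) (freshN i hp0)
      rw [← hN] at hl
      rw [show Instr.candidates (G.listsBy N₀ M₀) m (.anyNode i) = l ++ f i :: l' from hl]
      refine firstSuccess_append (fun d hd => ?_) ?_
      · simp only [Rule.extend, usedN d (hlo d hd) i hp0]
      · simp only [Rule.extend, h1]
        exact ih (o ++ [f i]) o' h2 hp2 (insN i) ho' (by rw [hN]; simp) hM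
    | outEdge e =>
      obtain ⟨hp0, hp1, hp2⟩ := hp
      obtain ⟨m', h1, h2⟩ := hm.bindEdge h e hp0 (r.L.edge e).tgt
      replace hN : N₀ = o ++ f (r.L.edge e).tgt :: p.map (fun s => f s.newNode) := hN
      replace hM : M₀ = o' ++ g e :: p.flatMap (fun s => s.newEdge.map g) := hM
      obtain ⟨l, l', hl, hlo⟩ := sortBy_split
        (o' := p.flatMap (fun s => s.newEdge.map g))
        (s := G.outEdges (f (r.L.edge e).src)) (c := g e)
        (by simp [HostGraph.outEdges, h.edge_mem, h.src]) (freshM e hp0)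
      rw [← hM] at hl
      rw [show Instr.candidates (G.listsBy N₀ M₀) m (.outEdge e) = l ++ g e :: l' by
        simp only [Instr.candidates, hm.node, if_pos hp1, Option.map_some, Option.getD_some]
        exact hl]
      refine firstSuccess_append (fun d hd => ?_) ?_
      · simp only [Rule.extend, usedM d (hlo d hd)]
      · simp only [Rule.extend, h.tgt, h1]
        exact ih (o ++ [f (r.L.edge e).tgt]) (o' ++ [g e]) h2 hp2 (insN _) (insM e)
          (by rw [hN]; simp) (by rw [hM]; simp)
    | inEdge e =>
      obtain ⟨hp0, hp1, hp2⟩ := hp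
      obtain ⟨m', h1, h2⟩ := hm.bindEdge h e hp0 (r.L.edge e).src
      replace hN : N₀ = o ++ f (r.L.edge e).src :: p.map (fun s => f s.newNode) := hN
      replace hM : M₀ = o' ++ g e :: p.flatMap (fun s => s.newEdge.map g) := hM
      obtain ⟨l, l', hl, hlo⟩ := sortBy_split
        (o' := p.flatMap (fun s => s.newEdge.map g))
        (s := G.inEdges (f (r.L.edge e).tgt)) (c := g e)
        (by simp [HostGraph.inEdges, h.edge_mem, h.tgt]) (freshM e hp0)
      rw [← hM] at hl
      rw [show Instr.candidates (G.listsBy N₀ M₀) m (.inEdge e) = l ++ g e :: l' by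
        simp only [Instr.candidates, hm.node, if_pos hp1, Option.map_some, Option.getD_some]
        exact hl]
      refine firstSuccess_append (fun d hd => ?_) ?_
      · simp only [Rule.extend, usedM d (hlo d hd)]
      · simp only [Rule.extend, h.src, h1]
        exact ih (o ++ [f (r.L.edge e).src]) (o' ++ [g e]) h2 hp2 (insN _) (insM e)
          (by rw [hN]; simp) (by rw [hM]; simp)

/-- Every match is found by the matching algorithm if the lists are ordered suitably. -/
theorem Rule.findMatch_complete {r : Rule} {G : HostGraph} {f g α} (h : r.IsMatch G f g α) :
    ∃ D, (r.findMatch G D).1 = some ⟨fun i => some (f i), fun e => some (g e)⟩ :=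
  ⟨_, Rule.Agree.search_eq h r.plan (N := ∅) (M := ∅) [] []
    ⟨by simp [Partial.empty], by simp [Partial.empty]⟩ r.plan_ok (by simp) (by simp) rfl rfl⟩

theorem Rule.succeeds_iff {r : Rule} {G H : HostGraph} :
    (∃ t, r.Succeeds G t H) ↔ r.Applies G H := by
  constructor
  · rintro ⟨t, D, f, g, s, -, -, α, f', g', h, h'⟩
    exact ⟨f, g, α, f', g', h, h'⟩
  · rintro ⟨f, g, α, f', g', h, h'⟩
    obtain ⟨D, hD⟩ := Rule.findMatch_complete h
    exact ⟨_, D, f, g, _, Prod.ext hD rfl, rfl, α, f', g', h, h'⟩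

/-- A rule can be applied at each of its matches. -/
theorem Rule.IsMatch.exists_result {r : Rule} {G : HostGraph} {f g α} (h : r.IsMatch G f g α) :
    ∃ f' g' H, r.IsResult G f g α f' g' H := by
  classical
  obtain ⟨B, hB⟩ : ∃ B, ∀ v ∈ G.V, v < B :=
    ⟨G.V.sup id + 1, fun v hv => Nat.lt_succ_of_le (Finset.le_sup (f := id) hv)⟩
  obtain ⟨B', hB'⟩ : ∃ B, ∀ v ∈ G.E, v < B :=
    ⟨G.E.sup id + 1, fun v hv => Nat.lt_succ_of_le (Finset.le_sup (f := id) hv)⟩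
  let f' : Fin r.R.n → ℕ := fun j => ((r.keep j).map f).getD (B + j)
  let g' : Fin r.R.k → ℕ := fun e => B' + e
  have f'_some : ∀ j i, r.keep j = some i → f' j = f i := fun j i hj => by simp [f', hj]
  have f'_none : ∀ j, r.keep j = none → f' j = B + j := fun j hj => by simp [f', hj]
  have hf' : Function.Injective f' := by
    intro j j' hjj
    cases hj : r.keep j with
    | some i =>
      cases hj' : r.keep j' with
      | some i' =>
        rw [f'_some _ _ hj, f'_some _ _ hj'] at hjj
        exact r.keep_inj j j' (by simp [hj]) (by rw [hj, hj', h.node_inj hjj])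
      | none =>
        rw [f'_some _ _ hj, f'_none _ hj'] at hjj
        have := hB _ (h.node_mem i); omega
    | none =>
      cases hj' : r.keep j' with
      | some i' =>
        rw [f'_none _ hj, f'_some _ _ hj'] at hjj
        have := hB _ (h.node_mem i'); omega
      | none =>
        rw [f'_none _ hj, f'_none _ hj'] at hjj
        exact Fin.ext (by omega)
  have hg' : Function.Injective g' := fun e e' hee => Fin.ext (by simpa [g'] using hee)
  have hg'E : ∀ e, g' e ∉ G.E := fun e he => by
    have := hB' _ he; simp only [g'] at this; omega
  let V : Finset ℕ := {v ∈ G.V | ¬ ∃ i, r.Deleted i ∧ f i = v} ∪ Finset.univ.image f'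
  let E : Finset ℕ := {c ∈ G.E | ¬ ∃ e, g e = c} ∪ Finset.univ.image g'
  have hV : ∀ v, v ∈ V ↔ (v ∈ G.V ∧ ¬ ∃ i, r.Deleted i ∧ f i = v) ∨ ∃ j, f' j = v := by
    intro v; simp [V]
  have hE : ∀ c, c ∈ E ↔ (c ∈ G.E ∧ ¬ ∃ e, g e = c) ∨ ∃ e, g' e = c := by
    intro c; simp [E]
  refine ⟨f', g',
    { V := V
      E := E
      src := Function.extend g' (fun e => f' (r.R.edge e).src) G.src
      tgt := Function.extend g' (fun e => f' (r.R.edge e).tgt) G.tgt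
      src_mem := ?_
      tgt_mem := ?_
      nodeLabel := Function.extend f' (fun j => α (r.R.node j).var) G.nodeLabel
      edgeLabel := Function.extend g' (fun e => α (r.R.edge e).var) G.edgeLabel
      nodeMark := Function.extend f' (fun j => (r.R.node j).mark) G.nodeMark
      edgeMark := Function.extend g' (fun e => (r.R.edge e).mark) G.edgeMark
      root := Function.extend f' (fun j => (r.R.node j).root) G.root }, ?_⟩
  · intro c hc
    by_cases hx : ∃ e, g' e = c
    · obtain ⟨e, rfl⟩ := hx
      rw [hg'.extend_apply]
      exact (hV _).2 (Or.inr ⟨_, rfl⟩)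
    · rw [Function.extend_apply' _ _ _ hx]
      obtain ⟨h1, h2⟩ := ((hE c).1 hc).resolve_right hx
      refine (hV _).2 (Or.inl ⟨G.src_mem c h1, ?_⟩)
      rintro ⟨i, hi, hi'⟩
      exact h2 (h.dangling i hi c h1 (Or.inl hi'.symm))
  · intro c hc
    by_cases hx : ∃ e, g' e = c
    · obtain ⟨e, rfl⟩ := hx
      rw [hg'.extend_apply]
      exact (hV _).2 (Or.inr ⟨_, rfl⟩)
    · rw [Function.extend_apply' _ _ _ hx]
      obtain ⟨h1, h2⟩ := ((hE c).1 hc).resolve_right hx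
      refine (hV _).2 (Or.inl ⟨G.tgt_mem c h1, ?_⟩)
      rintro ⟨i, hi, hi'⟩
      exact h2 (h.dangling i hi c h1 (Or.inr hi'.symm))
  · refine ⟨hf', hg', fun j i hi => f'_some j i hi, fun j hj hj' => ?_,
      fun e he => absurd he (hg'E e), hV, hE, fun v hv hvf => ?_, fun c hc hcg => ?_,
      fun j => ⟨hf'.extend_apply (fun j => α (r.R.node j).var) G.nodeLabel j,
        hf'.extend_apply (fun j => (r.R.node j).mark) G.nodeMark j,
        hf'.extend_apply (fun j => (r.R.node j).root) G.root j⟩,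
      fun e => ⟨hg'.extend_apply (fun e => f' (r.R.edge e).src) G.src e,
        hg'.extend_apply (fun e => f' (r.R.edge e).tgt) G.tgt e,
        hg'.extend_apply (fun e => α (r.R.edge e).var) G.edgeLabel e,
        hg'.extend_apply (fun e => (r.R.edge e).mark) G.edgeMark e⟩⟩
    · have := hB _ hj'
      rw [f'_none j hj] at this
      omega
    · have hx : ¬ ∃ j, f' j = v := by
        rintro ⟨j, rfl⟩
        cases hj : r.keep j with
        | some i => exact hvf ⟨i, (f'_some j i hj).symm⟩
        | none =>
          have := hB _ hv
          rw [f'_none j hj] at this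
          omega
      exact ⟨Function.extend_apply' (fun j => α (r.R.node j).var) G.nodeLabel v hx,
        Function.extend_apply' (fun j => (r.R.node j).mark) G.nodeMark v hx,
        Function.extend_apply' (fun j => (r.R.node j).root) G.root v hx⟩
    · have hx : ¬ ∃ e, g' e = c := by
        rintro ⟨e, rfl⟩
        exact hg'E e hc
      exact ⟨Function.extend_apply' (fun e => f' (r.R.edge e).src) G.src c hx,
        Function.extend_apply' (fun e => f' (r.R.edge e).tgt) G.tgt c hx,
        Function.extend_apply' (fun e => α (r.R.edge e).var) G.edgeLabel c hx,
        Function.extend_apply' (fun e => (r.R.edge e).mark) G.edgeMark c hx⟩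

theorem Rule.fails_iff {r : Rule} {G : HostGraph} :
    (∃ t, r.Fails G t) ↔ ¬ ∃ H, r.Applies G H := by
  have key : (∃ H, r.Applies G H) ↔ ∃ f g α, r.IsMatch G f g α := by
    constructor
    · rintro ⟨H, f, g, α, f', g', h, -⟩
      exact ⟨f, g, α, h⟩
    · rintro ⟨f, g, α, h⟩
      obtain ⟨f', g', H, h'⟩ := h.exists_result
      exact ⟨H, f, g, α, f', g', h, h'⟩
  rw [key]
  constructor
  · rintro ⟨t, D, h⟩
    exact Rule.findMatch_eq_none_iff.1 (by rw [h])
  · intro h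
    exact ⟨_, G.listsBy [] [], Prod.ext (Rule.findMatch_eq_none_iff.2 h) rfl⟩

theorem TryRules.sound {G : HostGraph} {rs : List Rule} {t : ℕ} {o : Option HostGraph}
    (h : TryRules G rs t o) :
    (∀ H, o = some H → ∃ r ∈ rs, r.Applies G H) ∧
      (o = none → ∀ r ∈ rs, ¬ ∃ H, r.Applies G H) := by
  induction h with
  | nil => simp
  | @hit r rs t H h =>
    refine ⟨fun H' hH' => ⟨r, by simp, ?_⟩, by simp⟩
    cases hH'
    exact Rule.succeeds_iff.1 ⟨_, h⟩
  | @miss r rs t t' o h _ ih =>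
    refine ⟨fun H hH => ?_, fun ho r' hr' => ?_⟩
    · obtain ⟨r', hr', h'⟩ := ih.1 H hH
      exact ⟨r', by simp [hr'], h'⟩
    · rcases List.mem_cons.1 hr' with rfl | hr'
      · exact Rule.fails_iff.1 ⟨_, h⟩
      · exact ih.2 ho r' hr'

/-- A rule-set call can produce `H` exactly if one of the rules can. -/
theorem call_some_iff {R : List Rule} {G H : HostGraph} :
    (∃ t, Call R G t (some H)) ↔ ∃ r ∈ R, r.Applies G H := by
  constructor
  · rintro ⟨t, rs, hrs, h⟩
    obtain ⟨r, hr, h'⟩ := h.sound.1 H rfl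
    exact ⟨r, hrs.mem_iff.1 hr, h'⟩
  · rintro ⟨r, hr, h⟩
    obtain ⟨l, l', rfl⟩ := List.append_of_mem hr
    obtain ⟨t, ht⟩ := Rule.succeeds_iff.2 h
    exact ⟨t, r :: (l ++ l'), List.perm_middle.symm, .hit ht⟩

/-- A rule-set call can fail exactly if no rule is applicable. -/
theorem call_none_iff {R : List Rule} {G : HostGraph} :
    (∃ t, Call R G t none) ↔ ¬ ∃ H, ∃ r ∈ R, r.Applies G H := by
  constructor
  · rintro ⟨t, rs, hrs, h⟩ ⟨H, r, hr, h'⟩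
    exact h.sound.2 rfl r (hrs.mem_iff.2 hr) ⟨H, h'⟩
  · intro h
    suffices ∃ t, TryRules G R t none by
      obtain ⟨t, ht⟩ := this
      exact ⟨t, R, List.Perm.refl _, ht⟩
    induction R with
    | nil => exact ⟨0, .nil⟩
    | cons r R ih =>
      obtain ⟨t', ht'⟩ := ih fun ⟨H, r', hr', h'⟩ => h ⟨H, r', by simp [hr'], h'⟩
      obtain ⟨t, ht⟩ := Rule.fails_iff.2 fun ⟨H, h'⟩ => h ⟨H, r, by simp, h'⟩
      exact ⟨_, .miss ht ht'⟩

end GP2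

namespace GP2

/-! ### Executions -/

-- Two things have to be shown: every rule call takes constant time, and the number of rule calls is
-- linear.
--
-- Most calls are cheap by the shape of the rules. There is never more than one root. A root that is
-- to be deleted must have exactly the degrees prescribed by the rule, hence at most two outgoing
-- edges, before any edge is searched. `init` is only called when all nodes are grey and unrooted,
-- so its first candidate succeeds. The critical rule is `up`, which runs through the incoming edges
-- of the root, and their number is unbounded. A candidate is skipped only if it is a loop or
-- dashed. Loops are also outgoing edges, and the condition outdeg < 3 leaves at most two of these.
-- For dashed edges the proof uses the invariant `balance` of `Active`: the dashed edges are
-- balanced like a trail from the root `u` to a start node `s`. It gives dashedIn u ≤ dashedOut u ≤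
-- outdeg u ≤ 2 (`Active.dashedIn_le`, `up_time`). The rule `up` preserves the invariant because it
-- prolongs the trail (`Active.of_up`). A deletion preserves it because the deleted root has no
-- incoming edge: either exactly one dashed edge leaves it and the trail is retraced, or the trail
-- is empty and a new one starts at the new root (`Active.of_delete_root`).
--
-- The calls are counted with the potential 10000 · (number of nodes) + 302 · (number of unmarked
-- edges). Each `up` uses up an unmarked edge, each deletion a node, and unmarked edges never come
-- back. A pass through the main loop that starts on a nonempty graph either deletes a node or ends
-- with the flag set, and then `Guard` leaves the loop. Since the remaining budget decreases
-- strictly, it is also the induction measure that excludes divergence (`reduceLoop_runs`,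
-- `mainLoop_runs`). The program ends with failure or with the empty graph, so writing the result is
-- free.
--
-- The bookkeeping is a timed program logic. `Runs P G b Post` bounds every execution, finished or
-- not, excludes getting stuck, and lets the postcondition mention the elapsed time, so that unspent
-- budget can be handed on to the next command.

theorem Steps.induction {motive : Config → ℕ → Config → Prop} (refl : ∀ γ, motive γ 0 γ)
    (head : ∀ P G t t' γ δ, Step P G t γ → Steps γ t' δ → motive γ t' δ →
      motive (.run P G) (t + t') δ) {γ t δ} (h : Steps γ t δ) : motive γ t δ :=
  -- `Step` and `Steps` are mutually inductive. The trivial motive for the fifteen rules of `Step`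
  -- leaves a plain induction over the transitions of a computation.
  Steps.rec (motive_1 := fun _ _ _ _ _ => True) (motive_2 := fun γ t δ _ => motive γ t δ)
    (fun _ => trivial) (fun _ => trivial) (fun _ _ => trivial) (fun _ _ => trivial)
    (fun _ _ => trivial) (fun _ _ => trivial) (fun _ _ => trivial) (fun _ _ => trivial)
    (fun _ _ => trivial) (fun _ _ => trivial) (fun _ _ => trivial) (fun _ _ => trivial)
    trivial trivial trivial (refl _) (fun h h' _ ih => head _ _ _ _ _ _ h h' ih) h

theorem Steps.trans {γ t δ} (h : Steps γ t δ) {t' ε} (h' : Steps δ t' ε) :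
    Steps γ (t + t') ε := by
  refine Steps.induction (motive := fun γ t δ => ∀ {t' ε}, Steps δ t' ε → Steps γ (t + t') ε)
    (fun γ t' ε h => by simpa using h) (fun P G t t' γ δ h _ ih t'' ε h' => ?_) h h'
  rw [add_assoc]
  exact .head h (ih h')

theorem Steps.single {P G t γ} (h : Step P G t γ) : Steps (.run P G) t γ :=
  .head h .refl

/-- Each transition is charged a unit of its own, except those that `seq` inherits from its first
command. This is what turns a time bound into termination. -/
theorem Step.pos {P : Com} : ∀ {G t γ}, Step P G t γ → 0 < t := by
  induction P with
  | seq P Q ihP _ =>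
    intro G t γ h
    cases h with
    | seq1 h => exact ihP h
    | seq2 h => exact ihP h
    | seq3 h => exact ihP h
    | brk => exact Nat.one_pos
  | _ => intro G t γ h; cases h <;> omega

theorem not_step_brk {G t γ} : ¬ Step .brk G t γ := nofun

theorem Steps.of_brk {G t γ} (h : Steps (.run .brk G) t γ) : t = 0 ∧ γ = .run .brk G := by
  cases h with
  | refl => exact ⟨rfl, rfl⟩
  | head h _ => exact absurd h not_step_brk

theorem Steps.of_graph {G t γ} (h : Steps (.graph G) t γ) : t = 0 ∧ γ = .graph G := by
  cases h; exact ⟨rfl, rfl⟩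

theorem Steps.of_fail {t γ} (h : Steps .fail t γ) : t = 0 ∧ γ = .fail := by
  cases h; exact ⟨rfl, rfl⟩

theorem Steps.elapsed {P G t γ} (h : Steps (.run P G) t γ) : Elapsed P G t := by
  refine Steps.induction (motive := fun γ t _ => ∀ P G, γ = .run P G → Elapsed P G t)
    (fun _ _ _ _ => .start) (fun P G t t' γ δ h hs ih P' G' hP => ?_) h P G rfl
  cases hP
  cases γ with
  | run Q H => exact .step h (ih _ _ rfl)
  | graph H => rw [hs.of_graph.1]; exact .done h
  | fail => rw [hs.of_fail.1]; exact .failed h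

/-- Configurations in which the execution of a command has ended. -/
def Config.Final : Config → Prop
  | .run P _ => P = .brk
  | .graph _ => True
  | .fail => True

/-- Every execution of `P` on `G` ends after time at most `b`, and `Post γ t` holds if it ends
in `γ` after time `t`. -/
structure Runs (P : Com) (G : HostGraph) (b : ℕ) (Post : Config → ℕ → Prop) : Prop where
  elapsed : ∀ t, Elapsed P G t → t ≤ b
  progress : ∀ t Q H, Steps (.run P G) t (.run Q H) → Q = .brk ∨ ∃ t' γ, Step Q H t' γ
  post : ∀ t γ, Steps (.run P G) t γ → γ.Final → Post γ t

theorem Runs.mono {P G b b'} {Post Post' : Config → ℕ → Prop} (h : Runs P G b Post)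
    (hb : b ≤ b') (hP : ∀ γ t, Post γ t → Post' γ t) : Runs P G b' Post' :=
  ⟨fun t ht => (h.elapsed t ht).trans hb, h.progress,
    fun t γ ht hγ => hP _ _ (h.post t γ ht hγ)⟩

/-- Otherwise `progress` would prolong the execution without end, and as each transition takes
positive time, the bound `b` would be exceeded. Branching commands and loops can only make a
transition once a subcomputation has ended, so this lemma is what keeps them from getting stuck. -/
theorem Runs.exists_final {P G b Post} (h : Runs P G b Post) :
    ∃ t γ, Steps (.run P G) t γ ∧ γ.Final ∧ Post γ t := by
  by_contra hn
  have hn : ∀ t γ, Steps (.run P G) t γ → ¬ γ.Final :=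
    fun t γ ht hγ => hn ⟨t, γ, ht, hγ, h.post t γ ht hγ⟩
  have key : ∀ n, ∃ t Q H, n ≤ t ∧ Steps (.run P G) t (.run Q H) := by
    intro n
    induction n with
    | zero => exact ⟨0, P, G, le_rfl, .refl⟩
    | succ n ih =>
      obtain ⟨t, Q, H, hnt, ht⟩ := ih
      obtain rfl | ⟨t', γ, hs⟩ := h.progress t Q H ht
      · exact absurd rfl (hn _ _ ht)
      · have ht' := ht.trans (.single hs)
        have := hs.pos
        cases γ with
        | run Q' H' => exact ⟨_, Q', H', by omega, ht'⟩
        | graph => exact absurd trivial (hn _ _ ht')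
        | fail => exact absurd trivial (hn _ _ ht')
  obtain ⟨t, Q, H, hbt, ht⟩ := key (b + 1)
  have := h.elapsed t ht.elapsed
  omega

/-- An infinite execution would accumulate more than `b` time units. `progress` tolerates stopping
at `break`, which for a whole program means getting stuck; `hbrk` excludes that. -/
theorem Runs.terminatesWithin {P G b B} {Post : Config → ℕ → Prop} (h : Runs P G b Post)
    (hb : G.size + b ≤ B) (hbrk : ∀ H t, ¬ Post (.run .brk H) t)
    (hout : ∀ H t, Post (.graph H) t → H.size = 0) : TerminatesWithin P G B where
  not_diverge := by
    rintro ⟨s, hs0, hs⟩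
    have key : ∀ n, ∃ t, n ≤ t ∧ Steps (.run P G) t (.run (s n).1 (s n).2) := by
      intro n
      induction n with
      | zero => exact ⟨0, le_rfl, by rw [hs0]; exact .refl⟩
      | succ n ih =>
        obtain ⟨t, hnt, ht⟩ := ih
        obtain ⟨t', ht'⟩ := hs n
        have := ht'.pos
        exact ⟨t + t', by omega, ht.trans (.single ht')⟩
    obtain ⟨t, hbt, ht⟩ := key (b + 1)
    have := h.elapsed t ht.elapsed
    omega
  not_stuck := by
    rintro ⟨t, Q, H, ht, hn⟩
    rcases h.progress t Q H ht with rfl | h'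
    · exact hbrk H t (h.post _ _ ht rfl)
    · exact hn h'
  elapsed := fun t ht => by have := h.elapsed t ht; omega
  output := fun t H ht => by
    have := h.elapsed t ht.elapsed
    have := hout H t (h.post _ _ ht trivial)
    omega

/-! ### Rules for the commands -/

theorem exists_call (R : List Rule) (G : HostGraph) : ∃ t o, Call R G t o := by
  by_cases h : ∃ H, ∃ r ∈ R, r.Applies G H
  · obtain ⟨H, hH⟩ := h
    obtain ⟨t, ht⟩ := call_some_iff.2 hH
    exact ⟨t, _, ht⟩
  · obtain ⟨t, ht⟩ := call_none_iff.2 h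
    exact ⟨t, _, ht⟩

theorem Runs.call {R G b} {Post : Config → ℕ → Prop}
    (hs : ∀ t H, Call R G t (some H) → t + 1 ≤ b ∧ Post (.graph H) (t + 1))
    (hf : ∀ t, Call R G t none → t + 1 ≤ b ∧ Post .fail (t + 1)) : Runs (.call R) G b Post where
  elapsed := by
    intro t h
    cases h with
    | start => exact Nat.zero_le _
    | step h => cases h
    | done h => cases h with | call1 h => exact (hs _ _ h).1
    | failed h => cases h with | call2 h => exact (hf _ h).1
  progress := by
    intro t Q H h
    cases h with
    | refl =>
      obtain ⟨t, o, h⟩ := exists_call R G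
      cases o with
      | none => exact .inr ⟨_, _, .call2 h⟩
      | some H => exact .inr ⟨_, _, .call1 h⟩
    | head h h' => cases h <;> cases h'
  post := by
    intro t γ h hγ
    cases h with
    | refl => cases hγ
    | head h h' =>
      cases h with
      | call1 h => obtain ⟨rfl, rfl⟩ := h'.of_graph; exact (hs _ _ h).2
      | call2 h => obtain ⟨rfl, rfl⟩ := h'.of_fail; exact (hf _ h).2

theorem Runs.skip {G} {Post : Config → ℕ → Prop} (h : Post (.graph G) 1) :
    Runs .skip G 1 Post where
  elapsed := by
    intro t h
    cases h with
    | start => omega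
    | step h => cases h
    | done h => cases h; exact le_rfl
    | failed h => cases h
  progress := by
    intro t Q H h
    cases h with
    | refl => exact .inr ⟨_, _, .skip⟩
    | head h h' => cases h; cases h'
  post := by
    intro t γ h hγ
    cases h with
    | refl => cases hγ
    | head h' h'' => cases h'; obtain ⟨rfl, rfl⟩ := h''.of_graph; exact h

theorem Runs.fail {G} {Post : Config → ℕ → Prop} (h : Post .fail 1) :
    Runs .fail G 1 Post where
  elapsed := by
    intro t h
    cases h with
    | start => omega
    | step h => cases h
    | done h => cases h
    | failed h => cases h; exact le_rfl
  progress := by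
    intro t Q H h
    cases h with
    | refl => exact .inr ⟨_, _, .fail⟩
    | head h h' => cases h; cases h'
  post := by
    intro t γ h hγ
    cases h with
    | refl => cases hγ
    | head h' h'' => cases h'; obtain ⟨rfl, rfl⟩ := h''.of_fail; exact h

theorem Runs.brk {G} {Post : Config → ℕ → Prop} (h : Post (.run .brk G) 0) :
    Runs .brk G 0 Post where
  elapsed := by
    intro t h
    cases h with
    | start => exact le_rfl
    | step h => cases h
    | done h => cases h
    | failed h => cases h
  progress := by
    intro t Q H h
    obtain ⟨-, h⟩ := h.of_brk
    cases h
    exact .inl rfl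
  post := by
    intro t γ h' _
    obtain ⟨rfl, rfl⟩ := h'.of_brk
    exact h

/-- An execution of `P; Q` that never breaks in `P` runs `P` to its end and `Q` afterwards. -/
theorem Steps.of_seq {P Q G t δ} (h : Steps (.run (.seq P Q) G) t δ) :
    (∃ P' H, δ = .run (.seq P' Q) H ∧ Steps (.run P G) t (.run P' H)) ∨
    (∃ t₁ t₂ H, t = t₁ + t₂ ∧ Steps (.run P G) t₁ (.graph H) ∧ Steps (.run Q H) t₂ δ) ∨
    (δ = .fail ∧ Steps (.run P G) t .fail) ∨
    ∃ t₁ H, Steps (.run P G) t₁ (.run .brk H) := by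
  refine Steps.induction (motive := fun γ t δ => ∀ P G, γ = .run (.seq P Q) G →
    (∃ P' H, δ = .run (.seq P' Q) H ∧ Steps (.run P G) t (.run P' H)) ∨
    (∃ t₁ t₂ H, t = t₁ + t₂ ∧ Steps (.run P G) t₁ (.graph H) ∧ Steps (.run Q H) t₂ δ) ∨
    (δ = .fail ∧ Steps (.run P G) t .fail) ∨
    ∃ t₁ H, Steps (.run P G) t₁ (.run .brk H))
    (fun γ P G hγ => .inl ⟨P, G, hγ, .refl⟩) (fun R G t t' γ δ h hs ih P G' hR => ?_) h P G rfl
  cases hR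
  cases h with
  | seq1 h =>
    rcases ih _ _ rfl with ⟨P', H, h1, h2⟩ | ⟨t₁, t₂, H, h1, h2, h3⟩ | ⟨h1, h2⟩ | ⟨t₁, H, h1⟩
    · exact .inl ⟨P', H, h1, .head h h2⟩
    · exact .inr (.inl ⟨_, t₂, H, by omega, .head h h2, h3⟩)
    · exact .inr (.inr (.inl ⟨h1, .head h h2⟩))
    · exact .inr (.inr (.inr ⟨_, H, .head h h1⟩))
  | seq2 h => exact .inr (.inl ⟨_, _, _, rfl, .single h, hs⟩)
  | seq3 h =>
    obtain ⟨rfl, rfl⟩ := hs.of_fail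
    exact .inr (.inr (.inl ⟨rfl, .single h⟩))
  | brk => exact .inr (.inr (.inr ⟨0, _, .refl⟩))

theorem Elapsed.of_seq {P Q G t} (h : Elapsed (.seq P Q) G t) :
    Elapsed P G t ∨
    (∃ t₁ t₂ H, t = t₁ + t₂ ∧ Steps (.run P G) t₁ (.graph H) ∧ Elapsed Q H t₂) ∨
    ∃ t₁ H, Steps (.run P G) t₁ (.run .brk H) := by
  generalize hR : Com.seq P Q = R at h
  induction h generalizing P with
  | start => exact .inl .start
  | step h h' ih =>
    subst hR
    cases h with
    | seq1 h =>
      rcases ih rfl with h1 | ⟨t₁, t₂, H, h1, h2, h3⟩ | ⟨t₁, H, h1⟩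
      · exact .inl (.step h h1)
      · exact .inr (.inl ⟨_, t₂, H, by omega, .head h h2, h3⟩)
      · exact .inr (.inr ⟨_, H, .head h h1⟩)
    | seq2 h => exact .inr (.inl ⟨_, _, _, rfl, .single h, h'⟩)
    | brk => exact .inr (.inr ⟨0, _, .refl⟩)
  | done h => subst hR; cases h
  | failed h =>
    subst hR
    cases h with
    | seq3 h => exact .inl (.failed h)
  | inSeq h => cases hR; exact .inl h
  | inIf => cases hR
  | inTry => cases hR
  | inLoop => cases hR

/-- The budget `b'` of the second command may depend on the intermediate graph and on the time
already spent, so that amortised bounds pass through. Only a `break` in the first command is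
excluded; one in the second is an admissible end, as needed for `Guard`, which comes last in the
loop body. -/
theorem Runs.seq {P Q G b} {Mid Post : Config → ℕ → Prop} (hP : Runs P G b Mid)
    (hbrk : ∀ H t, ¬ Mid (.run .brk H) t)
    (hfail : ∀ t, Mid .fail t → Post .fail t)
    (hQ : ∀ H t, Mid (.graph H) t →
      ∃ b', t + b' ≤ b ∧ Runs Q H b' fun γ s => Post γ (t + s)) :
    Runs (.seq P Q) G b Post := by
  have nobrk : ¬ ∃ t₁ H, Steps (.run P G) t₁ (.run .brk H) :=
    fun ⟨t, H, h⟩ => hbrk H t (hP.post _ _ h rfl)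
  refine ⟨fun t h => ?_, fun t R H h => ?_, fun t γ h hγ => ?_⟩
  · rcases h.of_seq with h | ⟨t₁, t₂, H, rfl, h1, h2⟩ | h
    · exact hP.elapsed _ h
    · obtain ⟨b', hb', h'⟩ := hQ H t₁ (hP.post _ _ h1 trivial)
      have := h'.elapsed _ h2
      omega
    · exact absurd h nobrk
  · rcases h.of_seq with ⟨P', H', h1, h2⟩ | ⟨t₁, t₂, H', rfl, h1, h2⟩ | ⟨h1, -⟩ | h
    · cases h1
      right
      rcases hP.progress _ _ _ h2 with rfl | ⟨t', γ, h3⟩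
      · exact ⟨_, _, .brk⟩
      · cases γ with
        | run => exact ⟨_, _, .seq1 h3⟩
        | graph => exact ⟨_, _, .seq2 h3⟩
        | fail => exact ⟨_, _, .seq3 h3⟩
    · obtain ⟨b', hb', h'⟩ := hQ H' t₁ (hP.post _ _ h1 trivial)
      exact h'.progress _ _ _ h2
    · cases h1
    · exact absurd h nobrk
  · rcases h.of_seq with ⟨P', H', h1, h2⟩ | ⟨t₁, t₂, H', rfl, h1, h2⟩ | ⟨rfl, h2⟩ | h
    · subst h1; cases hγ
    · obtain ⟨b', hb', h'⟩ := hQ H' t₁ (hP.post _ _ h1 trivial)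
      exact h'.post _ _ h2 hγ
    · exact hfail _ (hP.post _ _ h2 trivial)
    · exact absurd h nobrk

/-- The effect of the condition is undone in both outcomes, hence the factor two in both branches.
`hcb` covers executions that are still inside the condition, which `Elapsed` sees as well. -/
theorem Runs.ifElse {C P Q G c b} {Cond Post : Config → ℕ → Prop} (hC : Runs C G c Cond)
    (hcb : c ≤ b) (hbrk : ∀ H t, ¬ Cond (.run .brk H) t)
    (hP : ∀ H t, Cond (.graph H) t →
      ∃ b', 2 * t + 1 + b' ≤ b ∧ Runs P G b' fun γ s => Post γ (2 * t + 1 + s))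
    (hQ : ∀ t, Cond .fail t →
      ∃ b', 2 * t + 1 + b' ≤ b ∧ Runs Q G b' fun γ s => Post γ (2 * t + 1 + s)) :
    Runs (.ifElse C P Q) G b Post := by
  refine ⟨fun t h => ?_, fun t R H h => ?_, fun t γ h hγ => ?_⟩
  · cases h with
    | start => exact Nat.zero_le _
    | step h h' =>
      cases h with
      | if1 h =>
        obtain ⟨b', hb', h1⟩ := hP _ _ (hC.post _ _ h trivial)
        have := h1.elapsed _ h'
        omega
      | if2 h =>
        obtain ⟨b', hb', h1⟩ := hQ _ (hC.post _ _ h trivial)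
        have := h1.elapsed _ h'
        omega
    | done h => cases h
    | failed h => cases h
    | inIf h => exact (hC.elapsed _ h).trans hcb
  · cases h with
    | refl =>
      obtain ⟨t, γ, h, hγ, hc⟩ := hC.exists_final
      right
      cases γ with
      | run R H => cases hγ; exact absurd hc (hbrk _ _)
      | graph => exact ⟨_, _, .if1 h⟩
      | fail => exact ⟨_, _, .if2 h⟩
    | head h h' =>
      cases h with
      | if1 h =>
        obtain ⟨b', hb', h1⟩ := hP _ _ (hC.post _ _ h trivial)
        exact h1.progress _ _ _ h'
      | if2 h =>
        obtain ⟨b', hb', h1⟩ := hQ _ (hC.post _ _ h trivial)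
        exact h1.progress _ _ _ h'
  · cases h with
    | refl => cases hγ
    | head h h' =>
      cases h with
      | if1 h =>
        obtain ⟨b', hb', h1⟩ := hP _ _ (hC.post _ _ h trivial)
        exact h1.post _ _ h' hγ
      | if2 h =>
        obtain ⟨b', hb', h1⟩ := hQ _ (hC.post _ _ h trivial)
        exact h1.post _ _ h' hγ

/-- Only a failed condition is undone, so the factor two appears in `hQ` alone, and the success
branch continues on the graph that the condition produced. -/
theorem Runs.tryElse {C P Q G c b} {Cond Post : Config → ℕ → Prop} (hC : Runs C G c Cond)
    (hcb : c ≤ b) (hbrk : ∀ H t, ¬ Cond (.run .brk H) t)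
    (hP : ∀ H t, Cond (.graph H) t →
      ∃ b', t + 1 + b' ≤ b ∧ Runs P H b' fun γ s => Post γ (t + 1 + s))
    (hQ : ∀ t, Cond .fail t →
      ∃ b', 2 * t + 1 + b' ≤ b ∧ Runs Q G b' fun γ s => Post γ (2 * t + 1 + s)) :
    Runs (.tryElse C P Q) G b Post := by
  refine ⟨fun t h => ?_, fun t R H h => ?_, fun t γ h hγ => ?_⟩
  · cases h with
    | start => exact Nat.zero_le _
    | step h h' =>
      cases h with
      | try1 h =>
        obtain ⟨b', hb', h1⟩ := hP _ _ (hC.post _ _ h trivial)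
        have := h1.elapsed _ h'
        omega
      | try2 h =>
        obtain ⟨b', hb', h1⟩ := hQ _ (hC.post _ _ h trivial)
        have := h1.elapsed _ h'
        omega
    | done h => cases h
    | failed h => cases h
    | inTry h => exact (hC.elapsed _ h).trans hcb
  · cases h with
    | refl =>
      obtain ⟨t, γ, h, hγ, hc⟩ := hC.exists_final
      right
      cases γ with
      | run R H => cases hγ; exact absurd hc (hbrk _ _)
      | graph => exact ⟨_, _, .try1 h⟩
      | fail => exact ⟨_, _, .try2 h⟩
    | head h h' =>
      cases h with
      | try1 h =>
        obtain ⟨b', hb', h1⟩ := hP _ _ (hC.post _ _ h trivial)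
        exact h1.progress _ _ _ h'
      | try2 h =>
        obtain ⟨b', hb', h1⟩ := hQ _ (hC.post _ _ h trivial)
        exact h1.progress _ _ _ h'
  · cases h with
    | refl => cases hγ
    | head h h' =>
      cases h with
      | try1 h =>
        obtain ⟨b', hb', h1⟩ := hP _ _ (hC.post _ _ h trivial)
        exact h1.post _ _ h' hγ
      | try2 h =>
        obtain ⟨b', hb', h1⟩ := hQ _ (hC.post _ _ h trivial)
        exact h1.post _ _ h' hγ

/-- This unrolls a single iteration. The induction is left to the caller, through `hloop`, and runs
over the unmarked edges or over the remaining budget. -/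
theorem Runs.alap {P G c b} {Body Post : Config → ℕ → Prop} (hP : Runs P G c Body)
    (hcb : c ≤ b)
    (hbrk : ∀ H t, Body (.run .brk H) t → t + 1 ≤ b ∧ Post (.graph H) (t + 1))
    (hfail : ∀ t, Body .fail t → 2 * t + 1 ≤ b ∧ Post (.graph G) (2 * t + 1))
    (hloop : ∀ H t, Body (.graph H) t →
      ∃ b', t + 1 + b' ≤ b ∧ Runs (.alap P) H b' fun γ s => Post γ (t + 1 + s)) :
    Runs (.alap P) G b Post := by
  refine ⟨fun t h => ?_, fun t R H h => ?_, fun t γ h hγ => ?_⟩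
  · cases h with
    | start => exact Nat.zero_le _
    | step h h' =>
      cases h with
      | alap1 h =>
        obtain ⟨b', hb', h1⟩ := hloop _ _ (hP.post _ _ h trivial)
        have := h1.elapsed _ h'
        omega
    | done h =>
      cases h with
      | alap2 h => exact (hfail _ (hP.post _ _ h trivial)).1
      | alap3 h => exact (hbrk _ _ (hP.post _ _ h rfl)).1
    | failed h => cases h
    | inLoop h => exact (hP.elapsed _ h).trans hcb
  · cases h with
    | refl =>
      obtain ⟨t, γ, h, hγ, hc⟩ := hP.exists_final
      right
      cases γ with
      | run R H => cases hγ; exact ⟨_, _, .alap3 h⟩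
      | graph => exact ⟨_, _, .alap1 h⟩
      | fail => exact ⟨_, _, .alap2 h⟩
    | head h h' =>
      cases h with
      | alap1 h =>
        obtain ⟨b', hb', h1⟩ := hloop _ _ (hP.post _ _ h trivial)
        exact h1.progress _ _ _ h'
      | alap2 h => cases h'
      | alap3 h => cases h'
  · cases h with
    | refl => cases hγ
    | head h h' =>
      cases h with
      | alap1 h =>
        obtain ⟨b', hb', h1⟩ := hloop _ _ (hP.post _ _ h trivial)
        exact h1.post _ _ h' hγ
      | alap2 h =>
        obtain ⟨rfl, rfl⟩ := h'.of_graph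
        exact (hfail _ (hP.post _ _ h trivial)).2
      | alap3 h =>
        obtain ⟨rfl, rfl⟩ := h'.of_graph
        exact (hbrk _ _ (hP.post _ _ h rfl)).2

/-! ### The time of the matching algorithm -/

/-- Without repetitions at most `S.card` candidates can fail, and one more fetch either succeeds or
notices the end of the list. Each fetch costs at most `τ + 1`. The length of the list does not
matter. -/
theorem firstSuccess_time {β : Type} {k : ℕ → Option β × ℕ} {τ : ℕ} (S : Finset ℕ) :
    ∀ {l : List ℕ}, l.Nodup → (∀ c ∈ l, (k c).2 ≤ τ) → (∀ c ∈ l, (k c).1 = none → c ∈ S) →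
      (firstSuccess k l).2 ≤ (S.card + 1) * (τ + 1) := by
  intro l
  induction l generalizing S with
  | nil => intro _ _ _; simp only [firstSuccess]; nlinarith [Nat.zero_le (S.card * (τ + 1))]
  | cons c cs ih =>
    intro hn hk hS
    have hc := hk c (by simp)
    unfold firstSuccess
    split
    · rename_i b t hkc
      rw [hkc] at hc
      dsimp only at hc ⊢
      nlinarith [Nat.zero_le (S.card * (τ + 1))]
    · rename_i t hkc
      have hcS := hS c (by simp) (by rw [hkc])
      rw [hkc] at hc
      -- The failed candidate is charged to its element of `S` and cannot occur again.
      have hcs := ih (S.erase c) (List.nodup_cons.1 hn).2 (fun d hd => hk d (by simp [hd]))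
        fun d hd hd' => Finset.mem_erase.2
          ⟨fun h => (List.nodup_cons.1 hn).1 (h ▸ hd), hS d (by simp [hd]) hd'⟩
      rw [Finset.card_erase_add_one hcS] at hcs
      dsimp only at hc ⊢
      rw [add_mul, one_mul]
      omega

/-- Bound for the time of a search that runs through `n` nested lists of at most two edges. -/
def edgeSearchTime : ℕ → ℕ
  | 0 => 0
  | n + 1 => 3 * (edgeSearchTime n + 1)

theorem Rule.search_outEdges_time {r : Rule} {G : HostGraph} {D : G.Lists} {i₀ : Fin r.L.n}
    {u : ℕ} (hu : G.outdeg u ≤ 2) {p : List (Instr r.L)}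
    (hp : ∀ s ∈ p, ∃ e, s = .outEdge e ∧ (r.L.edge e).src = i₀) :
    ∀ {m : Partial r.L}, m.node i₀ = some u → (r.search G D p m).2 ≤ edgeSearchTime p.length := by
  induction p with
  | nil => intro m _; simp [Rule.search]
  | cons s p ih =>
    intro m hm
    obtain ⟨e, rfl, he⟩ := hp s (by simp)
    rw [Rule.search]
    have hcand : Instr.candidates D m (.outEdge e) = D.outE u := by
      simp [Instr.candidates, he, hm]
    rw [hcand]
    refine (firstSuccess_time (τ := edgeSearchTime p.length) (G.outEdges u) (D.nodup_outE u)
      (fun c _ => ?_) (fun c hc _ => (D.mem_outE u c).1 hc)).trans ?_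
    · split
      · exact Nat.zero_le _
      · rename_i m' hm'
        refine ih (fun s hs => hp s (by simp [hs])) ?_
        simp only [Rule.extend, Rule.bindEdge] at hm'
        split at hm'
        -- The image of `i₀` stays `u`: for a node that is matched already, `bindNode` can only
        -- confirm its image.
        · obtain ⟨-, h2, h3⟩ := Rule.bindNode_some hm'
          rw [h2, Function.update_apply]
          split
          · rename_i h
            rw [← h] at h3
            rcases h3 with h3 | h3
            · exact h3.symm.trans hm
            · exact absurd (h3.1.symm.trans hm) nofun
          · exact hm
        · cases hm'
    · exact Nat.mul_le_mul_right _ (by unfold HostGraph.outdeg at hu; omega)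

/-- A search that starts at the root takes constant time if there is at most one root and the
rest of the search does. -/
theorem Rule.findMatch_root_time {r : Rule} {G : HostGraph} {D : G.Lists} {i₀ : Fin r.L.n}
    {p : List (Instr r.L)} {u τ : ℕ} (hplan : r.plan = .rootNode i₀ :: p)
    (hroot : ∀ v ∈ G.V, G.root v = true → v = u)
    (hp : ∀ m : Partial r.L, u ∈ G.V → r.NodeOK G i₀ u →
      m.edge = (fun _ => none) → m.node = Function.update (fun _ => none) i₀ (some u) →
      (r.search G D p m).2 ≤ τ) :
    (r.findMatch G D).2 ≤ 2 * (τ + 1) := by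
  rw [Rule.findMatch, hplan, Rule.search]
  refine (firstSuccess_time (τ := τ) {u} D.nodup_roots (fun c hc => ?_) fun c hc _ => ?_).trans
    (by simp)
  · obtain ⟨hcV, hcr⟩ := (D.mem_roots c).1 hc
    obtain rfl := hroot c hcV hcr
    split
    · exact Nat.zero_le _
    · rename_i m' hm'
      rw [Rule.extend] at hm'
      obtain ⟨h1, h2, h3⟩ := Rule.bindNode_some hm'
      rcases h3 with h3 | h3
      · simp [Partial.empty] at h3
      · exact hp m' hcV h3.2.2 h1 h2
  · obtain ⟨hcV, hcr⟩ := (D.mem_roots c).1 hc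
    simpa using hroot c hcV hcr

/-- A long list of outgoing edges is never entered: if the plan contains edge searches, then the
root is to be deleted, and the degree check on the root has already forced its outdegree to be that
of the left-hand graph. -/
theorem Rule.findMatch_root_time' {r : Rule} {G : HostGraph} {D : G.Lists} {i₀ : Fin r.L.n}
    {es : List (Fin r.L.k)} {u : ℕ} (hplan : r.plan = .rootNode i₀ :: es.map .outEdge)
    (hroot : ∀ v ∈ G.V, G.root v = true → v = u)
    (hes : ∀ e ∈ es, (r.L.edge e).src = i₀)
    (hdel : es = [] ∨ r.Deleted i₀ ∧ r.L.outdeg i₀ ≤ 2) :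
    (r.findMatch G D).2 ≤ 2 * (edgeSearchTime es.length + 1) := by
  refine Rule.findMatch_root_time hplan hroot fun m _ hok _ hm => ?_
  rcases hdel with rfl | ⟨hd, h2⟩
  · simp [Rule.search]
  · rw [← List.length_map (f := Instr.outEdge (L := r.L))]
    refine Rule.search_outEdges_time (i₀ := i₀) (u := u) ?_ (fun s hs => ?_) (by simp [hm])
    · rw [(hok.2.2.2.2.2 hd).2]
      exact h2
    · obtain ⟨e, he, rfl⟩ := List.mem_map.1 hs
      exact ⟨e, rfl, hes e he⟩

/-- Looking for a single node takes constant time if every node passes the checks. -/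
theorem Rule.findMatch_anyNode_time {r : Rule} {G : HostGraph} {D : G.Lists} {i₀ : Fin r.L.n}
    (hplan : r.plan = [.anyNode i₀]) (hok : ∀ v ∈ G.V, r.NodeOK G i₀ v) :
    (r.findMatch G D).2 ≤ 1 := by
  rw [Rule.findMatch, hplan, Rule.search]
  -- No candidate fails, so the set of failures is empty and one fetch is enough.
  refine (firstSuccess_time (τ := 0) ∅ D.nodup_nodes (fun c _ => ?_) fun c hc hf => ?_).trans
    (by simp)
  · split
    · exact le_rfl
    · exact le_rfl
  · exfalso
    have : r.extend G (Partial.empty r.L) c (.anyNode i₀) =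
        some ⟨Function.update (fun _ => none) i₀ (some c), fun _ => none⟩ := by
      rw [Rule.extend, Rule.bindNode]
      exact if_pos ⟨fun j => by simp [Partial.empty], hok c ((D.mem_nodes c).1 hc)⟩
    rw [this] at hf
    simp [Rule.search] at hf

theorem TryRules.time_le {G : HostGraph} {rs : List Rule} {t o} (h : TryRules G rs t o) {K : ℕ}
    (hs : ∀ r ∈ rs, ∀ D : G.Lists, (r.findMatch G D).2 + r.applyTime ≤ K) :
    t ≤ K * rs.length := by
  induction h with
  | nil => simp
  | hit h =>
    obtain ⟨D, f, g, s, h1, rfl, -⟩ := h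
    have := hs _ List.mem_cons_self D
    rw [h1] at this
    rw [List.length_cons, mul_add, mul_one]
    exact this.trans (Nat.le_add_left _ _)
  | miss h _ ih =>
    obtain ⟨D, h1⟩ := h
    have := hs _ List.mem_cons_self D
    rw [h1] at this
    have := ih fun r hr => hs r (List.mem_cons_of_mem _ hr)
    rw [List.length_cons, mul_add, mul_one]
    omega

theorem Call.time_le {G : HostGraph} {R : List Rule} {t o} (h : Call R G t o) {K : ℕ}
    (hs : ∀ r ∈ R, ∀ D : G.Lists, (r.findMatch G D).2 + r.applyTime ≤ K) :
    t ≤ K * R.length := by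
  obtain ⟨rs, hrs, h⟩ := h
  rw [← hrs.length_eq]
  exact h.time_le fun r hr => hs r (hrs.mem_iff.1 hr)

namespace IsBinDag

-- Constant time bounds for the rule calls

theorem Delete_time {G : HostGraph} {u : ℕ} (hroot : ∀ v ∈ G.V, G.root v = true → v = u) {t o}
    (h : Call [del1, del1_d, del21, del21_d, del22, del22_d, del0] G t o) : t ≤ 300 := by
  have h1 := fun D : G.Lists => del1.findMatch_root_time' (D := D) (i₀ := ⟨1, by decide⟩)
    (es := [⟨0, by decide⟩]) rfl hroot (by decide) (.inr (by decide))
  have h2 := fun D : G.Lists => del1_d.findMatch_root_time' (D := D) (i₀ := ⟨1, by decide⟩)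
    (es := [⟨0, by decide⟩]) rfl hroot (by decide) (.inr (by decide))
  have h3 := fun D : G.Lists => del21.findMatch_root_time' (D := D) (i₀ := ⟨1, by decide⟩)
    (es := [⟨0, by decide⟩, ⟨1, by decide⟩]) rfl hroot (by decide) (.inr (by decide))
  have h4 := fun D : G.Lists => del21_d.findMatch_root_time' (D := D) (i₀ := ⟨1, by decide⟩)
    (es := [⟨0, by decide⟩, ⟨1, by decide⟩]) rfl hroot (by decide) (.inr (by decide))
  have h5 := fun D : G.Lists => del22.findMatch_root_time' (D := D) (i₀ := ⟨2, by decide⟩)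
    (es := [⟨0, by decide⟩, ⟨1, by decide⟩]) rfl hroot (by decide) (.inr (by decide))
  have h6 := fun D : G.Lists => del22_d.findMatch_root_time' (D := D) (i₀ := ⟨2, by decide⟩)
    (es := [⟨0, by decide⟩, ⟨1, by decide⟩]) rfl hroot (by decide) (.inr (by decide))
  have h7 := fun D : G.Lists => del0.findMatch_root_time' (D := D) (i₀ := ⟨0, by decide⟩)
    (es := []) rfl hroot (by decide) (.inl rfl)
  -- The longest search, with two nested edge lists, takes at most 2 · (12 + 1) = 26, and an
  -- application at most 7. Seven rules at 40 each stay below 300, the common bound used for all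
  -- calls.
  refine (h.time_le (K := 40) ?_).trans (by simp)
  intro r hr D
  simp only [List.mem_cons, List.not_mem_nil, or_false] at hr
  rcases hr with rfl | rfl | rfl | rfl | rfl | rfl | rfl
  · exact (Nat.add_le_add_right (h1 D) _).trans (by decide)
  · exact (Nat.add_le_add_right (h2 D) _).trans (by decide)
  · exact (Nat.add_le_add_right (h3 D) _).trans (by decide)
  · exact (Nat.add_le_add_right (h4 D) _).trans (by decide)
  · exact (Nat.add_le_add_right (h5 D) _).trans (by decide)
  · exact (Nat.add_le_add_right (h6 D) _).trans (by decide)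
  · exact (Nat.add_le_add_right (h7 D) _).trans (by decide)

theorem set_flag_time {G : HostGraph} {u : ℕ} (hroot : ∀ v ∈ G.V, G.root v = true → v = u) {t o}
    (h : Call [set_flag] G t o) : t ≤ 300 := by
  refine (h.time_le (K := 300) fun r hr D => ?_).trans (by simp)
  obtain rfl := List.mem_singleton.1 hr
  exact (Nat.add_le_add_right (set_flag.findMatch_root_time' (i₀ := ⟨0, by decide⟩)
    (es := []) rfl hroot (by decide) (.inl rfl)) _).trans (by decide)

theorem flag_time {G : HostGraph} {u : ℕ} (hroot : ∀ v ∈ G.V, G.root v = true → v = u) {t o}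
    (h : Call [flag] G t o) : t ≤ 300 := by
  refine (h.time_le (K := 300) fun r hr D => ?_).trans (by simp)
  obtain rfl := List.mem_singleton.1 hr
  exact (Nat.add_le_add_right (flag.findMatch_root_time' (i₀ := ⟨0, by decide⟩)
    (es := []) rfl hroot (by decide) (.inl rfl)) _).trans (by decide)

/-- The uniform marks are essential: otherwise the search could reject arbitrarily many nodes before
it finds a grey unrooted one. -/
theorem init_time {G : HostGraph} (hgrey : ∀ v ∈ G.V, G.nodeMark v = .grey ∧ G.root v = false)
    {t o} (h : Call [init] G t o) : t ≤ 300 := by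
  refine (h.time_le (K := 300) fun r hr D => ?_).trans (by simp)
  obtain rfl := List.mem_singleton.1 hr
  refine (Nat.add_le_add_right (init.findMatch_anyNode_time (i₀ := ⟨0, by decide⟩) rfl
    fun v hv => ?_) _).trans (by decide)
  obtain ⟨h1, h2⟩ := hgrey v hv
  exact ⟨h1, h2, fun d hd => absurd hd (by simp [init]), Nat.zero_le _, Nat.zero_le _,
    fun h => absurd h (by decide)⟩

/-- The number of dashed edges that enter `v`. -/
def dashedIn (G : HostGraph) (v : ℕ) : ℕ :=
  (G.E.filter fun e => G.edgeMark e = .dashed ∧ G.tgt e = v).card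

/-- The number of dashed edges that leave `v`. -/
def dashedOut (G : HostGraph) (v : ℕ) : ℕ :=
  (G.E.filter fun e => G.edgeMark e = .dashed ∧ G.src e = v).card

theorem dashedOut_le_outdeg (G : HostGraph) (v : ℕ) : dashedOut G v ≤ G.outdeg v :=
  Finset.card_le_card fun e he => by
    simp only [Finset.mem_filter, HostGraph.outEdges] at he ⊢
    exact ⟨he.1, he.2.2⟩

/-- The only incoming edges of the root that `up` skips are dashed edges and loops. -/
theorem up_time {G : HostGraph} {u : ℕ} (hroot : ∀ v ∈ G.V, G.root v = true → v = u)
    (hmark : ∀ e ∈ G.E, G.edgeMark e = .unmarked ∨ G.edgeMark e = .dashed)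
    (hu : u ∈ G.V → G.root u = true → G.nodeMark u = .grey →
      (∀ v ∈ G.V, G.nodeMark v = .grey) ∧ dashedIn G u ≤ dashedOut G u)
    {t o} (h : Call [up] G t o) : t ≤ 300 := by
  refine (h.time_le (K := 300) fun r hr D => ?_).trans (by simp)
  obtain rfl := List.mem_singleton.1 hr
  refine (Nat.add_le_add_right (up.findMatch_root_time (i₀ := ⟨0, by decide⟩) (τ := 5)
    (p := [.inEdge ⟨0, by decide⟩]) rfl hroot fun m huV hok hme hmn => ?_) _).trans (by decide)
  -- The edge search is entered only if `u` has passed the checks as a grey root. On graphs without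
  -- a grey root, `hu` holds vacuously.
  obtain ⟨hgrey, hle⟩ := hu huV hok.2.1 hok.1
  have hout : G.outdeg u < 3 := hok.2.2.1 3 rfl
  have hnode : m.node ⟨0, by decide⟩ = some u := by rw [hmn]; rfl
  rw [Rule.search, show Instr.candidates (L := up.L) D m (.inEdge ⟨0, by decide⟩) = D.inE u by
    show ((m.node ⟨0, by decide⟩).map D.inE).getD [] = _
    rw [hnode]; rfl]
  -- At most two edges leave `u`. This bounds the loops, which are among them, and through `hle`
  -- also the dashed edges that enter `u`.
  have hS : ((G.E.filter fun e => G.edgeMark e = .dashed ∧ G.tgt e = u) ∪ G.outEdges u).card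
      ≤ 4 := by
    refine (Finset.card_union_le _ _).trans ?_
    have := dashedOut_le_outdeg G u
    unfold dashedIn at hle
    unfold HostGraph.outdeg at *
    omega
  -- Nothing follows this edge in the plan, so `τ = 0`; four failures and one further fetch give the
  -- 5 chosen above.
  refine (firstSuccess_time (τ := 0)
    ((G.E.filter fun e => G.edgeMark e = .dashed ∧ G.tgt e = u) ∪ G.outEdges u)
    (D.nodup_inE u) (fun c _ => ?_) fun c hc hf => ?_).trans (by omega)
  · split
    · exact le_rfl
    · exact le_rfl
  -- An unmarked incoming edge that is not a loop always succeeds: its source is grey, not in use,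
  -- and unrooted because `u` is the only root.
  · by_contra hcS
    have hc := (D.mem_inE u c).1 hc
    simp only [HostGraph.inEdges, HostGraph.outEdges, Finset.mem_filter, Finset.mem_union,
      not_or, not_and] at hc hcS
    have hun : G.edgeMark c = .unmarked :=
      (hmark c hc.1).resolve_right fun h => hcS.1 hc.1 h hc.2
    have hsu : G.src c ≠ u := hcS.2 hc.1
    have hsV := G.src_mem c hc.1
    have hok1 : up.NodeOK G ⟨1, by decide⟩ (G.src c) := by
      refine ⟨hgrey _ hsV, ?_, ?_, Nat.zero_le _, ?_, fun h => absurd h (by decide)⟩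
      · cases hr : G.root (G.src c) with
        | false => rfl
        | true => exact absurd (hroot _ hsV hr) hsu
      · intro d hd
        exact absurd hd (by simp [up])
      · refine (show up.L.outdeg ⟨1, by decide⟩ ≤ 1 by decide).trans ?_
        exact Finset.card_pos.2 ⟨c, by simp [HostGraph.outEdges, hc.1]⟩
    have hex : (up.extend G m c (.inEdge ⟨0, by decide⟩)).isSome = true := by
      show (up.bindEdge G ⟨0, by decide⟩ c ⟨1, by decide⟩ (G.src c) m).isSome = true
      unfold Rule.bindEdge
      rw [if_pos ⟨fun e => by simp [hme], hun⟩]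
      unfold Rule.bindNode
      have h1 : m.node ⟨1, by decide⟩ = none := by rw [hmn]; rfl
      dsimp only
      rw [h1]
      dsimp only
      rw [if_pos]
      · rfl
      · refine ⟨fun j => ?_, hok1⟩
        rw [hmn, Function.update_apply]
        split
        · simpa using hsu.symm
        · simp
    obtain ⟨m', hm'⟩ := Option.isSome_iff_exists.1 hex
    rw [hm'] at hf
    simp [Rule.search] at hf

end IsBinDag

/-! ### Rule applications -/

theorem Rule.IsResult.mem_E {r : Rule} {G H : HostGraph} {f g α f' g'}
    (h : r.IsResult G f g α f' g' H) (hR : r.R.k = 0) {c : ℕ} :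
    c ∈ H.E ↔ c ∈ G.E ∧ ¬ ∃ e, g e = c := by
  rw [h.edges, or_iff_left]
  rintro ⟨e, -⟩
  exact absurd e.2 (by omega)

theorem Rule.IsResult.mem_V {r : Rule} {G H : HostGraph} {f g α f' g'}
    (hm : r.IsMatch G f g α) (h : r.IsResult G f g α f' g' H)
    (hk : ∀ j, r.keep j ≠ none) {v : ℕ} :
    v ∈ H.V ↔ v ∈ G.V ∧ ¬ ∃ i, r.Deleted i ∧ f i = v := by
  rw [h.nodes, or_iff_left_of_imp]
  rintro ⟨j, rfl⟩
  obtain ⟨i, hi⟩ := Option.ne_none_iff_exists'.1 (hk j)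
  rw [h.kept j i hi]
  refine ⟨hm.node_mem i, ?_⟩
  rintro ⟨i', hi', hii⟩
  exact hi' j (by rw [hi, hm.node_inj hii])

theorem Rule.IsResult.node_cases {r : Rule} {G H : HostGraph} {f g α f' g'}
    (hm : r.IsMatch G f g α) (h : r.IsResult G f g α f' g' H)
    (hk : ∀ j, r.keep j ≠ none) {v : ℕ} (hv : v ∈ H.V) :
    (v ∈ G.V ∧ (¬ ∃ i, f i = v) ∧ H.nodeMark v = G.nodeMark v ∧ H.root v = G.root v) ∨
    ∃ j i, r.keep j = some i ∧ f i = v ∧ H.nodeMark v = (r.R.node j).mark ∧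
      H.root v = (r.R.node j).root := by
  obtain ⟨hvG, hnd⟩ := (Rule.IsResult.mem_V hm h hk).1 hv
  by_cases hx : ∃ i, f i = v
  · obtain ⟨i, rfl⟩ := hx
    have : ¬ r.Deleted i := fun hd => hnd ⟨i, hd, rfl⟩
    simp only [Rule.Deleted, not_forall, not_not] at this
    obtain ⟨j, hj⟩ := this
    have hn := h.new_node j
    rw [h.kept j i hj] at hn
    exact .inr ⟨j, i, hj, rfl, hn.2⟩
  · exact .inl ⟨hvG, hx, (h.old_node v hvG hx).2⟩

/-- A rule that consists of a single preserved node can be applied at every node that has the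
right mark and rootedness. -/
theorem Rule.applies_of_node {r : Rule} {G : HostGraph} {i₀ : Fin r.L.n} (hi : ∀ i, i = i₀)
    (hL : r.L.k = 0) (hd : ¬ r.Deleted i₀) (hc : r.outdegLT i₀ = none) {v : ℕ} (hv : v ∈ G.V)
    (hmark : G.nodeMark v = (r.L.node i₀).mark) (hroot : G.root v = (r.L.node i₀).root) :
    ∃ H, r.Applies G H := by
  have : IsEmpty (Fin r.L.k) := by rw [hL]; infer_instance
  have hm : r.IsMatch G (fun _ => v) isEmptyElim (fun _ => G.nodeLabel v) := by
    refine ⟨fun i j _ => (hi i).trans (hi j).symm, isEmptyElim, fun _ => hv, isEmptyElim,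
      isEmptyElim, isEmptyElim, fun _ => rfl, isEmptyElim, fun i => ?_, isEmptyElim, fun i => ?_,
      fun i d h => ?_, fun i h => ?_⟩
    · rw [hi i]; exact hmark
    · rw [hi i]; exact hroot
    · rw [hi i, hc] at h; cases h
    · rw [hi i] at h; exact absurd h hd
  obtain ⟨f', g', H, h⟩ := hm.exists_result
  exact ⟨H, _, _, _, _, _, hm, h⟩

namespace IsBinDag

/-! ### The phases of the program -/

/-- The number of unmarked edges. -/
def unmarkedEdges (G : HostGraph) : ℕ := (G.E.filter fun e => G.edgeMark e = .unmarked).card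

/-- The graphs between two iterations of the main loop. -/
structure Idle (G : HostGraph) : Prop where
  edge : ∀ e ∈ G.E, G.edgeMark e = .unmarked ∨ G.edgeMark e = .dashed
  grey : ∀ v ∈ G.V, G.nodeMark v = .grey
  root : ∀ v ∈ G.V, G.root v = false
  balance : ∀ v ∈ G.V, dashedOut G v = dashedIn G v

/-- The graphs with a single root `u`, which is grey. The dashed edges are balanced as if they
formed a trail from `u` to the node `s` where the search for a source started. -/
structure Active (G : HostGraph) (u : ℕ) : Prop where
  mem : u ∈ G.V
  edge : ∀ e ∈ G.E, G.edgeMark e = .unmarked ∨ G.edgeMark e = .dashed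
  grey : ∀ v ∈ G.V, G.nodeMark v = .grey
  root : ∀ v ∈ G.V, G.root v = true ↔ v = u
  balance : ∃ s, ∀ v ∈ G.V,
    dashedOut G v + (if v = s then 1 else 0) = dashedIn G v + if v = u then 1 else 0

/-- The graphs with a single root `u`, which is unmarked. -/
structure Flagged (G : HostGraph) (u : ℕ) : Prop where
  mem : u ∈ G.V
  edge : ∀ e ∈ G.E, G.edgeMark e = .unmarked ∨ G.edgeMark e = .dashed
  mark : G.nodeMark u = .unmarked
  root : ∀ v ∈ G.V, G.root v = true ↔ v = u

/-- At the root, the side of the incoming edges carries an extra 1, and the other side at most one.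
-/
theorem Active.dashedIn_le {G : HostGraph} {u : ℕ} (h : Active G u) :
    dashedIn G u ≤ dashedOut G u := by
  obtain ⟨s, hs⟩ := h.balance
  have := hs u h.mem
  rw [if_pos rfl] at this
  split at this <;> omega

-- The single-node rules `init`, `set_flag` and `flag`

theorem dashedOut_congr {G H : HostGraph} (hE : H.E = G.E)
    (h : ∀ c ∈ G.E, H.src c = G.src c ∧ H.edgeMark c = G.edgeMark c) (v : ℕ) :
    dashedOut H v = dashedOut G v := by
  unfold dashedOut
  rw [hE]
  congr 1
  exact Finset.filter_congr fun c hc => by rw [(h c hc).1, (h c hc).2]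

theorem dashedIn_congr {G H : HostGraph} (hE : H.E = G.E)
    (h : ∀ c ∈ G.E, H.tgt c = G.tgt c ∧ H.edgeMark c = G.edgeMark c) (v : ℕ) :
    dashedIn H v = dashedIn G v := by
  unfold dashedIn
  rw [hE]
  congr 1
  exact Finset.filter_congr fun c hc => by rw [(h c hc).1, (h c hc).2]

theorem unmarkedEdges_congr {G H : HostGraph} (hE : H.E = G.E)
    (h : ∀ c ∈ G.E, H.edgeMark c = G.edgeMark c) : unmarkedEdges H = unmarkedEdges G := by
  unfold unmarkedEdges
  rw [hE]
  congr 1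
  exact Finset.filter_congr fun c hc => by rw [h c hc]

/-- The effect of a rule that consists of a single preserved node. -/
theorem relabel_of_applies {r : Rule} {G H : HostGraph} {i₀ : Fin r.L.n} (hi : ∀ i, i = i₀)
    (hL : r.L.k = 0) (hR : r.R.k = 0) (hk : ∀ j, r.keep j ≠ none) (hd : ¬ r.Deleted i₀)
    (h : r.Applies G H) :
    ∃ u j, u ∈ G.V ∧ G.root u = (r.L.node i₀).root ∧ H.V = G.V ∧ H.E = G.E ∧
      (∀ c ∈ G.E, H.src c = G.src c ∧ H.tgt c = G.tgt c ∧ H.edgeMark c = G.edgeMark c) ∧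
      (∀ v ∈ G.V, v ≠ u → H.nodeMark v = G.nodeMark v ∧ H.root v = G.root v) ∧
      H.nodeMark u = (r.R.node j).mark ∧ H.root u = (r.R.node j).root := by
  obtain ⟨f, g, α, f', g', hm, h⟩ := h
  have hV : H.V = G.V := by
    ext v
    rw [Rule.IsResult.mem_V hm h hk, and_iff_left]
    rintro ⟨i, h1, -⟩
    exact hd (hi i ▸ h1)
  have hg : ∀ c, ¬ ∃ e, g e = c := by
    rintro c ⟨e, -⟩
    exact absurd e.2 (by omega)
  have hE : H.E = G.E := by
    ext c
    rw [h.mem_E hR, and_iff_left (hg c)]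
  have hu : f i₀ ∈ H.V := hV ▸ hm.node_mem i₀
  rcases Rule.IsResult.node_cases hm h hk hu with ⟨-, h1, -⟩ | ⟨j, i, -, -, h1, h2⟩
  · exact absurd ⟨i₀, rfl⟩ h1
  · refine ⟨f i₀, j, hm.node_mem i₀, hm.root i₀, hV, hE, fun c hc => ?_, fun v hv hne => ?_,
      h1, h2⟩
    · obtain ⟨h1, h2, -, h3⟩ := h.old_edge c hc (hg c)
      exact ⟨h1, h2, h3⟩
    · refine (h.old_node v hv ?_).2
      rintro ⟨i, rfl⟩
      exact hne (by rw [hi i])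

theorem Idle.of_init {G H : HostGraph} (hG : Idle G) (h : init.Applies G H) :
    ∃ u, Active H u ∧ H.V = G.V ∧ unmarkedEdges H = unmarkedEdges G := by
  obtain ⟨u, j, hu, -, hV, hE, hedge, hold, hmu, hru⟩ :=
    relabel_of_applies (i₀ := ⟨0, by decide⟩) (by decide) rfl rfl (by decide) (by decide) h
  have hR : ∀ j, (init.R.node j).mark = .grey ∧ (init.R.node j).root = true := by decide
  -- The second `u` is the start node of the trail. The trail is empty, so its two indicators
  -- cancel.
  refine ⟨u, ⟨hV ▸ hu, fun e he => ?_, fun v hv => ?_, fun v hv => ?_, u, fun v hv => ?_⟩, hV,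
    unmarkedEdges_congr hE fun c hc => (hedge c hc).2.2⟩
  · rw [hE] at he
    rw [(hedge e he).2.2]
    exact hG.edge e he
  · rw [hV] at hv
    by_cases hvu : v = u
    · rw [hvu, hmu, (hR j).1]
    · rw [(hold v hv hvu).1, hG.grey v hv]
  · rw [hV] at hv
    by_cases hvu : v = u
    · simp [hvu, hru, (hR j).2]
    · simp [hvu, (hold v hv hvu).2, hG.root v hv]
  · rw [hV] at hv
    rw [dashedOut_congr hE (fun c hc => ⟨(hedge c hc).1, (hedge c hc).2.2⟩),
      dashedIn_congr hE (fun c hc => (hedge c hc).2), hG.balance v hv]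

theorem Idle.init_applies {G : HostGraph} (hG : Idle G) {v : ℕ} (hv : v ∈ G.V) :
    ∃ H, init.Applies G H :=
  Rule.applies_of_node (r := init) (i₀ := ⟨0, Nat.one_pos⟩) (by decide) rfl (by decide) rfl hv (hG.grey v hv)
    (hG.root v hv)

theorem Active.of_set_flag {G H : HostGraph} {u : ℕ} (hG : Active G u)
    (h : set_flag.Applies G H) : Flagged H u := by
  obtain ⟨u', j, hu, hr, hV, hE, hedge, hold, hmu, hru⟩ :=
    relabel_of_applies (i₀ := ⟨0, by decide⟩) (by decide) rfl rfl (by decide) (by decide) h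
  have hR : ∀ j, (set_flag.R.node j).mark = .unmarked ∧
      (set_flag.R.node j).root = true := by decide
  obtain rfl := (hG.root u' hu).1 hr
  refine ⟨hV ▸ hu, fun e he => ?_, by rw [hmu, (hR j).1], fun v hv => ?_⟩
  · rw [hE] at he
    rw [(hedge e he).2.2]
    exact hG.edge e he
  · rw [hV] at hv
    by_cases hvu : v = u'
    · simp [hvu, hru, (hR j).2]
    · rw [(hold v hv hvu).2, hG.root v hv]

theorem Active.set_flag_applies {G : HostGraph} {u : ℕ} (hG : Active G u) :
    ∃ H, set_flag.Applies G H :=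
  Rule.applies_of_node (r := set_flag) (i₀ := ⟨0, Nat.one_pos⟩) (by decide) rfl (by decide) rfl hG.mem
    (hG.grey u hG.mem) ((hG.root u hG.mem).2 rfl)

theorem Flagged.flag_applies {G : HostGraph} {u : ℕ} (hG : Flagged G u) :
    ∃ H, flag.Applies G H :=
  Rule.applies_of_node (r := flag) (i₀ := ⟨0, Nat.one_pos⟩) (by decide) rfl (by decide) rfl hG.mem
    hG.mark ((hG.root u hG.mem).2 rfl)

theorem Idle.not_applies {G : HostGraph} (hG : Idle G) {r : Rule}
    (hr : ∃ i, (r.L.node i).root = true) : ¬ ∃ H, r.Applies G H := by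
  rintro ⟨H, f, g, α, f', g', hm, -⟩
  obtain ⟨i, hi⟩ := hr
  have := hm.root i
  rw [hi, hG.root _ (hm.node_mem i)] at this
  cases this

theorem Flagged.not_applies {G : HostGraph} {u : ℕ} (hG : Flagged G u) {r : Rule}
    (hr : ∃ i, (r.L.node i).root = true ∧ (r.L.node i).mark = .grey) :
    ¬ ∃ H, r.Applies G H := by
  rintro ⟨H, f, g, α, f', g', hm, -⟩
  obtain ⟨i, hi, hi'⟩ := hr
  have h1 := hm.root i
  have h2 := hm.node_mark i
  rw [hi] at h1
  rw [(hG.root _ (hm.node_mem i)).1 h1, hG.mark, hi'] at h2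
  cases h2

-- The rule `up`

/-- The effect of `up`. -/
theorem up_effect {G H : HostGraph} (h : up.Applies G H) :
    ∃ u v c c', u ≠ v ∧ u ∈ G.V ∧ v ∈ G.V ∧ G.root u = true ∧
      c ∈ G.E ∧ G.edgeMark c = .unmarked ∧
      (c' ∈ G.E → c' = c) ∧ (∀ x, x ∈ H.V ↔ x ∈ G.V) ∧
      (∀ x, x ∈ H.E ↔ x = c' ∨ x ≠ c ∧ x ∈ G.E) ∧
      (∀ x ∈ G.V, x ≠ u → x ≠ v → H.nodeMark x = G.nodeMark x ∧ H.root x = G.root x) ∧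
      H.nodeMark u = .grey ∧ H.root u = false ∧ H.nodeMark v = .grey ∧ H.root v = true ∧
      (∀ x ∈ G.E, x ≠ c → H.src x = G.src x ∧ H.tgt x = G.tgt x ∧
        H.edgeMark x = G.edgeMark x) ∧
      H.src c' = v ∧ H.tgt c' = u ∧ H.edgeMark c' = .dashed := by
  obtain ⟨f, g, α, f', g', hm, h⟩ := h
  have hi : ∀ i : Fin up.L.n, i = ⟨0, by decide⟩ ∨ i = ⟨1, by decide⟩ := by decide
  have he : ∀ e : Fin up.L.k, e = ⟨0, by decide⟩ := by decide
  have he' : ∀ e : Fin up.R.k, e = ⟨0, by decide⟩ := by decide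
  have h0 := h.kept ⟨0, by decide⟩ ⟨0, by decide⟩ rfl
  have h1 := h.kept ⟨1, by decide⟩ ⟨1, by decide⟩ rfl
  have n0 := h.new_node ⟨0, by decide⟩
  have n1 := h.new_node ⟨1, by decide⟩
  have ne := h.new_edge ⟨0, by decide⟩
  rw [h0] at n0
  rw [h1] at n1
  refine ⟨f ⟨0, by decide⟩, f ⟨1, by decide⟩, g ⟨0, by decide⟩, g' ⟨0, by decide⟩, ?_,
    hm.node_mem _, hm.node_mem _, hm.root _, hm.edge_mem _, hm.edge_mark _, fun hc => ?_,
    fun x => ?_, fun x => ?_, fun x hx hxu hxv => ?_, n0.2.1, n0.2.2, n1.2.1, n1.2.2,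
    fun x hx hxc => ?_, ne.1.trans h1, ne.2.1.trans h0, ne.2.2.2⟩
  · intro hx
    exact absurd (hm.node_inj hx) (by decide)
  · obtain ⟨e, hx⟩ := h.fresh_edge _ hc
    rw [← hx, he e]
  · rw [Rule.IsResult.mem_V hm h (by decide), and_iff_left]
    rintro ⟨i, hx, -⟩
    exact absurd hx ((by decide : ∀ i, ¬ up.Deleted i) i)
  · rw [h.edges]
    constructor
    · rintro (⟨hx, hn⟩ | ⟨e, rfl⟩)
      · exact .inr ⟨fun hxc => hn ⟨_, hxc.symm⟩, hx⟩
      · exact .inl (by rw [he' e])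
    · rintro (rfl | ⟨hn, hx⟩)
      · exact .inr ⟨_, rfl⟩
      · refine .inl ⟨hx, ?_⟩
        rintro ⟨e, rfl⟩
        exact hn (by rw [he e])
  · refine (h.old_node x hx ?_).2
    rintro ⟨i, rfl⟩
    rcases hi i with rfl | rfl
    · exact hxu rfl
    · exact hxv rfl
  · obtain ⟨h1, h2, -, h3⟩ := h.old_edge x hx (by rintro ⟨e, rfl⟩; exact hxc (by rw [he e]))
    exact ⟨h1, h2, h3⟩

/-- The new dashed edge leads from the new root `v` to `u`. It adds one to `dashedOut` at `v` and to
`dashedIn` at `u`, and moving the root indicator from `u` to `v` compensates both, with the same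
start node `s`. -/
theorem Active.of_up {G H : HostGraph} {u : ℕ} (hG : Active G u) (h : up.Applies G H) :
    ∃ v, Active H v ∧ H.V = G.V ∧ unmarkedEdges H + 1 = unmarkedEdges G := by
  obtain ⟨u', v, c, c', huv, hu, hv, hru, hc, hcm, hc', hV, hE, hold, hmu', hru', hmv, hrv,
    hedge, hsrc, htgt, hdash⟩ := up_effect h
  obtain rfl := (hG.root u' hu).1 hru
  have hV : H.V = G.V := Finset.ext hV
  have hE : H.E = insert c' (G.E.erase c) := by
    ext x
    rw [hE, Finset.mem_insert, Finset.mem_erase]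
  -- The new edge may reuse the name of the edge that it replaces, so it is fresh only relative to
  -- the other edges.
  have hc'E : c' ∉ G.E.erase c := fun hx =>
    (Finset.mem_erase.1 hx).1 (hc' (Finset.mem_erase.1 hx).2)
  have hcc : ∀ x, G.edgeMark x = .dashed → x ≠ c := by
    rintro x hx rfl
    rw [hcm] at hx
    cases hx
  have hout : ∀ w, dashedOut H w = dashedOut G w + if w = v then 1 else 0 := by
    intro w
    have key : ((G.E.erase c).filter fun e => H.edgeMark e = .dashed ∧ H.src e = w) =
        G.E.filter fun e => G.edgeMark e = .dashed ∧ G.src e = w := by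
      ext x
      simp only [Finset.mem_filter, Finset.mem_erase]
      constructor
      · rintro ⟨⟨h1, h2⟩, h3⟩
        rw [(hedge x h2 h1).1, (hedge x h2 h1).2.2] at h3
        exact ⟨h2, h3⟩
      · rintro ⟨h2, h3⟩
        have h1 := hcc x h3.1
        rw [(hedge x h2 h1).1, (hedge x h2 h1).2.2]
        exact ⟨⟨h1, h2⟩, h3⟩
    unfold dashedOut
    rw [hE, Finset.filter_insert, key]
    by_cases hw : w = v
    · rw [if_pos ⟨hdash, hsrc.trans hw.symm⟩, if_pos hw, Finset.card_insert_of_notMem]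
      rw [← key]
      exact fun hx => hc'E (Finset.mem_filter.1 hx).1
    · rw [if_neg fun hx => hw (hx.2.symm.trans hsrc), if_neg hw]
      rfl
  have hin : ∀ w, dashedIn H w = dashedIn G w + if w = u' then 1 else 0 := by
    intro w
    have key : ((G.E.erase c).filter fun e => H.edgeMark e = .dashed ∧ H.tgt e = w) =
        G.E.filter fun e => G.edgeMark e = .dashed ∧ G.tgt e = w := by
      ext x
      simp only [Finset.mem_filter, Finset.mem_erase]
      constructor
      · rintro ⟨⟨h1, h2⟩, h3⟩
        rw [(hedge x h2 h1).2.1, (hedge x h2 h1).2.2] at h3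
        exact ⟨h2, h3⟩
      · rintro ⟨h2, h3⟩
        have h1 := hcc x h3.1
        rw [(hedge x h2 h1).2.1, (hedge x h2 h1).2.2]
        exact ⟨⟨h1, h2⟩, h3⟩
    unfold dashedIn
    rw [hE, Finset.filter_insert, key]
    by_cases hw : w = u'
    · rw [if_pos ⟨hdash, htgt.trans hw.symm⟩, if_pos hw, Finset.card_insert_of_notMem]
      rw [← key]
      exact fun hx => hc'E (Finset.mem_filter.1 hx).1
    · rw [if_neg fun hx => hw (hx.2.symm.trans htgt), if_neg hw]
      rfl
  refine ⟨v, ⟨hV ▸ hv, fun e he => ?_, fun w hw => ?_, fun w hw => ?_, ?_⟩, hV, ?_⟩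
  · rw [hE, Finset.mem_insert, Finset.mem_erase] at he
    rcases he with rfl | ⟨h1, h2⟩
    · exact .inr hdash
    · rw [(hedge e h2 h1).2.2]
      exact hG.edge e h2
  · rw [hV] at hw
    by_cases h1 : w = u'
    · rw [h1, hmu']
    · by_cases h2 : w = v
      · rw [h2, hmv]
      · rw [(hold w hw h1 h2).1, hG.grey w hw]
  · rw [hV] at hw
    by_cases h1 : w = u'
    · simp [h1, hru', huv]
    · by_cases h2 : w = v
      · simp [h2, hrv]
      · rw [(hold w hw h1 h2).2, hG.root w hw]
        simp [h1, h2]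
  · obtain ⟨s, hs⟩ := hG.balance
    refine ⟨s, fun w hw => ?_⟩
    rw [hV] at hw
    have := hs w hw
    rw [hout, hin]
    omega
  · have : (H.E.filter fun e => H.edgeMark e = .unmarked) =
        (G.E.filter fun e => G.edgeMark e = .unmarked).erase c := by
      ext x
      simp only [hE, Finset.mem_filter, Finset.mem_insert, Finset.mem_erase]
      constructor
      · rintro ⟨rfl | ⟨h1, h2⟩, h3⟩
        · rw [hdash] at h3; cases h3
        · rw [(hedge x h2 h1).2.2] at h3
          exact ⟨h1, h2, h3⟩
      · rintro ⟨h1, h2, h3⟩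
        rw [(hedge x h2 h1).2.2]
        exact ⟨.inr ⟨h1, h2⟩, h3⟩
    unfold unmarkedEdges
    rw [this, Finset.card_erase_add_one (Finset.mem_filter.2 ⟨hc, hcm⟩)]

-- The rules of `Delete`

/-- A rule that deletes the root together with its outgoing edges, at most one of which is dashed,
and makes the target of that edge the new root. -/
theorem Active.of_delete_root {r : Rule} {i₀ : Fin r.L.n} (hR : r.R.k = 0) (hk : ∀ j, r.keep j ≠ none)
    (hdel : ∀ i, r.Deleted i ↔ i = i₀) (hsrc : ∀ e, (r.L.edge e).src = i₀)
    (htgt : ∀ e, (r.L.edge e).tgt ≠ i₀) (hroot : (r.L.node i₀).root = true)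
    (hgrey : ∀ j, (r.R.node j).mark = .grey)
    (hshape : (r.L.k = 0 ∧ ∀ j, (r.R.node j).root = false) ∨
      ∃ e₀, (∀ e, e ≠ e₀ → (r.L.edge e).mark = .unmarked) ∧
        ∀ j, (r.R.node j).root = true ↔ r.keep j = some (r.L.edge e₀).tgt)
    {G H : HostGraph} {u : ℕ} (hG : Active G u) (h : r.Applies G H) :
    (Idle H ∨ ∃ v, Active H v) ∧ H.V.card + 1 = G.V.card ∧
      unmarkedEdges H ≤ unmarkedEdges G := by
  obtain ⟨f, g, α, f', g', hm, h⟩ := h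
  have hfu : f i₀ = u := (hG.root _ (hm.node_mem i₀)).1 ((hm.root i₀).trans hroot)
  have hV : H.V = G.V.erase u := by
    ext v
    rw [Rule.IsResult.mem_V hm h hk, Finset.mem_erase, and_comm, ← hfu]
    simp only [hdel, exists_eq_left, ne_eq, eq_comm (a := v)]
  have hE : ∀ {c}, c ∈ H.E ↔ c ∈ G.E ∧ ¬ ∃ e, g e = c := h.mem_E hR
  have hold : ∀ c ∈ H.E, H.src c = G.src c ∧ H.tgt c = G.tgt c ∧
      H.edgeMark c = G.edgeMark c := fun c hc => by
    obtain ⟨h1, h2, -, h3⟩ := h.old_edge c (hE.1 hc).1 (hE.1 hc).2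
    exact ⟨h1, h2, h3⟩
  have hedge : ∀ e ∈ H.E, H.edgeMark e = .unmarked ∨ H.edgeMark e = .dashed := fun e he => by
    rw [(hold e he).2.2]
    exact hG.edge e (hE.1 he).1
  have hnode : ∀ v ∈ H.V, H.nodeMark v = .grey := fun v hv => by
    rcases Rule.IsResult.node_cases hm h hk hv with ⟨h1, -, h2, -⟩ | ⟨j, i, -, -, h1, -⟩
    · rw [h2, hG.grey v h1]
    · rw [h1, hgrey]
  -- All deleted edges leave `u`, so the other nodes keep their outgoing dashed edges.
  have hout : ∀ w ≠ u, dashedOut H w = dashedOut G w := by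
    intro w hw
    unfold dashedOut
    congr 1
    ext c
    simp only [Finset.mem_filter]
    constructor
    · rintro ⟨h1, h2⟩
      rw [(hold c h1).1, (hold c h1).2.2] at h2
      exact ⟨(hE.1 h1).1, h2⟩
    · rintro ⟨h1, h2⟩
      have hc : c ∈ H.E := hE.2 ⟨h1, by
        rintro ⟨e, rfl⟩
        rw [hm.src, hsrc, hfu] at h2
        exact hw h2.2.symm⟩
      rw [(hold c hc).1, (hold c hc).2.2]
      exact ⟨hc, h2⟩
  have hin : ∀ w, (∀ e, (r.L.edge e).mark = .dashed → f (r.L.edge e).tgt ≠ w) →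
      dashedIn H w = dashedIn G w := by
    intro w hw
    unfold dashedIn
    congr 1
    ext c
    simp only [Finset.mem_filter]
    constructor
    · rintro ⟨h1, h2⟩
      rw [(hold c h1).2.1, (hold c h1).2.2] at h2
      exact ⟨(hE.1 h1).1, h2⟩
    · rintro ⟨h1, h2⟩
      have hc : c ∈ H.E := hE.2 ⟨h1, by
        rintro ⟨e, rfl⟩
        rw [hm.tgt, hm.edge_mark] at h2
        exact hw e h2.1 h2.2⟩
      rw [(hold c hc).2.1, (hold c hc).2.2]
      exact ⟨hc, h2⟩
  -- By the dangling condition every edge that enters `u` is matched, but no matched edge ends in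
  -- `u`.
  have hinu : dashedIn G u = 0 := by
    unfold dashedIn
    rw [Finset.card_eq_zero, Finset.filter_eq_empty_iff]
    rintro c hc ⟨-, h2⟩
    obtain ⟨e, rfl⟩ := hm.dangling i₀ ((hdel i₀).2 rfl) c hc (.inr (h2.trans hfu.symm))
    rw [hm.tgt, ← hfu] at h2
    exact htgt e (hm.node_inj h2)
  have houtu : (∀ e, (r.L.edge e).mark ≠ .dashed) → dashedOut G u = 0 := by
    intro hd
    unfold dashedOut
    rw [Finset.card_eq_zero, Finset.filter_eq_empty_iff]
    rintro c hc ⟨h1, h2⟩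
    obtain ⟨e, rfl⟩ := hm.dangling i₀ ((hdel i₀).2 rfl) c hc (.inl (h2.trans hfu.symm))
    rw [hm.edge_mark] at h1
    exact hd e h1
  obtain ⟨s, hs⟩ := hG.balance
  -- With nothing dashed coming in, the balance at `u` leaves two cases: no dashed edge leaves `u`
  -- and `u = s`, or exactly one does and `u ≠ s`.
  have hsu := hs u hG.mem
  rw [if_pos rfl, hinu] at hsu
  refine ⟨?_, by rw [hV, Finset.card_erase_add_one hG.mem], Finset.card_le_card fun c hc => ?_⟩
  swap
  · simp only [Finset.mem_filter] at hc ⊢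
    rw [(hold c hc.1).2.2] at hc
    exact ⟨(hE.1 hc.1).1, hc.2⟩
  rcases hshape with ⟨hL, hRr⟩ | ⟨e₀, hmark, hRr⟩
  · have hemp : ∀ e : Fin r.L.k, False := fun e => absurd e.2 (by omega)
    -- The trail is empty. Both indicators disappear together with `u`, so the remaining nodes are
    -- balanced without them.
    have hus : u = s := by
      by_contra hne
      rw [houtu fun e => (hemp e).elim, if_neg hne] at hsu
      omega
    refine .inl ⟨hedge, hnode, fun v hv => ?_, fun v hv => ?_⟩
    · rcases Rule.IsResult.node_cases hm h hk hv with ⟨h1, h2, -, h3⟩ | ⟨j, i, -, -, -, h1⟩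
      · rw [h3]
        refine Bool.eq_false_iff.2 fun h4 => h2 ⟨i₀, ?_⟩
        rw [hfu, (hG.root v h1).1 h4]
      · rw [h1, hRr]
    · rw [hV, Finset.mem_erase] at hv
      have := hs v hv.2
      rw [if_neg hv.1, if_neg fun h => hv.1 (h.trans hus.symm)] at this
      rw [hout v hv.1, hin v fun e => (hemp e).elim]
      exact this
  · have hvu : f (r.L.edge e₀).tgt ≠ u := fun h => htgt e₀ (hm.node_inj (h.trans hfu.symm))
    refine .inr ⟨f (r.L.edge e₀).tgt, ?_, hedge, hnode, fun v hv => ?_, ?_⟩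
    · rw [hV, Finset.mem_erase]
      exact ⟨hvu, hm.node_mem _⟩
    · rcases Rule.IsResult.node_cases hm h hk hv with ⟨h1, h2, -, h3⟩ | ⟨j, i, h1, rfl, -, h2⟩
      · rw [h3, hG.root v h1]
        constructor
        · rintro rfl
          exact absurd ⟨i₀, hfu⟩ h2
        · rintro rfl
          exact absurd ⟨_, rfl⟩ h2
      · rw [h2, hRr, h1, Option.some_inj, hm.node_inj.eq_iff]
    -- If `e₀` is dashed, the trail loses its first edge and keeps its start node `s`: the new root
    -- loses one incoming dashed edge and gains the root indicator instead. If not, the trail was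
    -- empty, and a new empty trail starts at the new root.
    · by_cases hd : (r.L.edge e₀).mark = .dashed
      · have hou : dashedOut G u = 1 := by
          unfold dashedOut
          rw [Finset.card_eq_one]
          refine ⟨g e₀, Finset.ext fun c => ?_⟩
          simp only [Finset.mem_filter, Finset.mem_singleton]
          constructor
          · rintro ⟨hc, h1, h2⟩
            obtain ⟨e, rfl⟩ := hm.dangling i₀ ((hdel i₀).2 rfl) c hc (.inl (h2.trans hfu.symm))
            by_contra hne
            rw [hm.edge_mark, hmark e fun h => hne (by rw [h])] at h1
            cases h1
          · rintro rfl
            exact ⟨hm.edge_mem _, (hm.edge_mark _).trans hd, by rw [hm.src, hsrc, hfu]⟩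
        have hus : u ≠ s := by
          rintro rfl
          rw [hou, if_pos rfl] at hsu
          omega
        refine ⟨s, fun w hw => ?_⟩
        rw [hV, Finset.mem_erase] at hw
        have hsw := hs w hw.2
        rw [if_neg hw.1] at hsw
        rw [hout w hw.1]
        by_cases hwv : w = f (r.L.edge e₀).tgt
        · have : dashedIn H w + 1 = dashedIn G w := by
            unfold dashedIn
            rw [← Finset.card_erase_add_one (a := g e₀)
              (s := G.E.filter fun e => G.edgeMark e = .dashed ∧ G.tgt e = w)]
            · congr 2
              ext c
              simp only [Finset.mem_filter, Finset.mem_erase]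
              constructor
              · rintro ⟨h1, h2⟩
                rw [(hold c h1).2.1, (hold c h1).2.2] at h2
                exact ⟨fun h => (hE.1 h1).2 ⟨e₀, h.symm⟩, (hE.1 h1).1, h2⟩
              · rintro ⟨h0, h1, h2⟩
                have hc : c ∈ H.E := hE.2 ⟨h1, by
                  rintro ⟨e, rfl⟩
                  rw [hm.edge_mark, hmark e fun h => h0 (by rw [h])] at h2
                  cases h2.1⟩
                rw [(hold c hc).2.1, (hold c hc).2.2]
                exact ⟨hc, h2⟩
            · simp only [Finset.mem_filter]
              exact ⟨hm.edge_mem _, (hm.edge_mark _).trans hd, (hm.tgt _).trans hwv.symm⟩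
          rw [if_pos hwv]
          omega
        · rw [hin w, if_neg hwv]
          · exact hsw
          · rintro e he rfl
            by_cases hee : e = e₀
            · exact hwv (by rw [hee])
            · rw [hmark e hee] at he
              cases he
      · have hnd : ∀ e, (r.L.edge e).mark ≠ .dashed := by
          intro e he
          by_cases hee : e = e₀
          · exact hd (hee ▸ he)
          · rw [hmark e hee] at he
            cases he
        have hus : u = s := by
          by_contra hne
          rw [houtu hnd, if_neg hne] at hsu
          omega
        refine ⟨f (r.L.edge e₀).tgt, fun w hw => ?_⟩
        rw [hV, Finset.mem_erase] at hw
        have hsw := hs w hw.2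
        rw [if_neg hw.1, if_neg fun h => hw.1 (h.trans hus.symm)] at hsw
        rw [hout w hw.1, hin w fun e he => absurd he (hnd e)]
        omega

theorem Active.of_Delete {G H : HostGraph} {u : ℕ} (hG : Active G u)
    {r : Rule} (hr : r ∈ [del1, del1_d, del21, del21_d, del22, del22_d, del0])
    (h : r.Applies G H) :
    (Idle H ∨ ∃ v, Active H v) ∧ H.V.card + 1 = G.V.card ∧
      unmarkedEdges H ≤ unmarkedEdges G := by
  simp only [List.mem_cons, List.not_mem_nil, or_false] at hr
  rcases hr with rfl | rfl | rfl | rfl | rfl | rfl | rfl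
  iterate 4
    exact hG.of_delete_root (i₀ := ⟨1, by decide⟩) rfl (by decide) (by decide) (by decide) (by decide)
      (by decide) (by decide) (.inr ⟨⟨0, by decide⟩, by decide, by decide⟩) h
  iterate 2
    exact hG.of_delete_root (i₀ := ⟨2, by decide⟩) rfl (by decide) (by decide) (by decide) (by decide)
      (by decide) (by decide) (.inr ⟨⟨0, by decide⟩, by decide, by decide⟩) h
  exact hG.of_delete_root (i₀ := ⟨0, by decide⟩) rfl (by decide) (by decide) (by decide) (by decide)
    (by decide) (by decide) (.inl ⟨rfl, by decide⟩) h

/-! ### The running time of the program -/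

/-- The value 0 is arbitrary, as there are no roots; it puts rootless graphs into the form that the
time bounds expect. -/
theorem Idle.root_unique {G : HostGraph} (hG : Idle G) :
    ∀ v ∈ G.V, G.root v = true → v = 0 := fun v hv h => by
  rw [hG.root v hv] at h
  cases h

theorem not_applies_of_call {R : List Rule} {G H : HostGraph} {t : ℕ}
    (hR : ∀ r ∈ R, ¬ ∃ H, r.Applies G H) : ¬ Call R G t (some H) := fun h =>
  let ⟨r, hr, h'⟩ := call_some_iff.1 ⟨t, h⟩
  hR r hr ⟨H, h'⟩

theorem applies_of_call {r : Rule} {G H : HostGraph} {t : ℕ} (h : Call [r] G t (some H)) :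
    r.Applies G H := by
  obtain ⟨r', hr, h'⟩ := call_some_iff.1 ⟨t, h⟩
  rwa [List.mem_singleton.1 hr] at h'

theorem not_call_none {r : Rule} {G : HostGraph} {t : ℕ} (hr : ∃ H, r.Applies G H) :
    ¬ Call [r] G t none := fun h =>
  let ⟨H, h'⟩ := hr
  call_none_iff.1 ⟨t, h⟩ ⟨H, r, List.mem_singleton.2 rfl, h'⟩

-- The loop `up!`

/-- A successful iteration costs at most 302 (300 for the rule, one for the call, one for the loop)
and consumes an unmarked edge. The failing one at the end costs 2 · 301 + 1 = 603. The postcondition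
hands on the share of the unmarked edges that are left. -/
theorem upLoop_runs_active : ∀ (n : ℕ) {G : HostGraph} {u : ℕ}, Active G u →
    unmarkedEdges G = n → Runs (.alap (.call [up])) G (302 * n + 603) fun γ t =>
      ∃ H v, γ = .graph H ∧ Active H v ∧ H.V = G.V ∧
        t + 302 * unmarkedEdges H ≤ 302 * n + 603 := by
  intro n
  induction n with
  | zero =>
    intro G u hG hn
    have htime : ∀ {t o}, Call [up] G t o → t ≤ 300 := up_time (fun v hv => (hG.root v hv).1)
      hG.edge fun _ _ _ => ⟨hG.grey, hG.dashedIn_le⟩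
    refine Runs.alap (c := 301) (Body := fun γ t => γ = .fail ∧ t ≤ 301)
      (Runs.call (fun t H h => ?_) fun t h => ?_) (by omega) (by simp) (fun t h => ?_) (by simp)
    -- Success is impossible, since `up` would consume an unmarked edge and there is none.
    · obtain ⟨v, -, -, h3⟩ := hG.of_up (applies_of_call h)
      omega
    · have := htime h
      exact ⟨by omega, rfl, by omega⟩
    · exact ⟨by omega, G, u, rfl, hG, rfl, by omega⟩
  | succ n ih =>
    intro G u hG hn
    have htime : ∀ {t o}, Call [up] G t o → t ≤ 300 := up_time (fun v hv => (hG.root v hv).1)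
      hG.edge fun _ _ _ => ⟨hG.grey, hG.dashedIn_le⟩
    refine Runs.alap (c := 301)
      (Body := fun γ t => t ≤ 301 ∧ (γ = .fail ∨ ∃ H v, γ = .graph H ∧ Active H v ∧ H.V = G.V ∧
        unmarkedEdges H = n))
      (Runs.call (fun t H h => ?_) fun t h => ?_) (by omega) (by simp) (fun t h => ?_)
      fun H t h => ?_
    · obtain ⟨v, h1, h2, h3⟩ := hG.of_up (applies_of_call h)
      have := htime h
      exact ⟨by omega, by omega, .inr ⟨H, v, rfl, h1, h2, by omega⟩⟩
    · have := htime h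
      exact ⟨by omega, by omega, .inl rfl⟩
    · exact ⟨by omega, G, u, rfl, hG, rfl, by omega⟩
    · obtain ⟨ht, h | ⟨H', v, hH, h1, h2, h3⟩⟩ := h
      · cases h
      · cases hH
        refine ⟨_, ?_, (ih h1 h3).mono le_rfl ?_⟩
        · omega
        · rintro γ s ⟨H', w, rfl, h4, h5, h6⟩
          exact ⟨H', w, rfl, h4, h5.trans h2, by omega⟩

-- The loop `Reduce!`

/-- The graphs without a grey root. -/
def Stopped (G : HostGraph) : Prop := Idle G ∨ ∃ u, Flagged G u

theorem Stopped.root_unique {G : HostGraph} (hG : Stopped G) :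
    ∃ u, ∀ v ∈ G.V, G.root v = true → v = u := by
  rcases hG with hG | ⟨u, hG⟩
  · exact ⟨0, hG.root_unique⟩
  · exact ⟨u, fun v hv => (hG.root v hv).1⟩

theorem Stopped.not_applies {G : HostGraph} (hG : Stopped G) {r : Rule}
    (hr : ∃ i, (r.L.node i).root = true ∧ (r.L.node i).mark = .grey) :
    ¬ ∃ H, r.Applies G H := by
  rcases hG with hG | ⟨u, hG⟩
  · exact hG.not_applies (hr.imp fun i h => h.1)
  · exact hG.not_applies hr

theorem Stopped.up_time {G : HostGraph} (hG : Stopped G) {t o} (h : Call [up] G t o) :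
    t ≤ 300 := by
  rcases hG with hG | ⟨u, hG⟩
  · exact IsBinDag.up_time hG.root_unique hG.edge
      (fun h1 h2 => absurd h2 (by rw [hG.root _ h1]; nofun)) h
  · exact IsBinDag.up_time (fun v hv => (hG.root v hv).1) hG.edge
      (fun _ _ h3 => absurd h3 (by rw [hG.mark]; nofun)) h

theorem Stopped.not_Delete {G : HostGraph} (hG : Stopped G) :
    ∀ r ∈ [del1, del1_d, del21, del21_d, del22, del22_d, del0], ¬ ∃ H, r.Applies G H := by
  intro r hr
  simp only [List.mem_cons, List.not_mem_nil, or_false] at hr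
  rcases hr with rfl | rfl | rfl | rfl | rfl | rfl | rfl <;> exact hG.not_applies (by decide)

/-- This is how `Reduce!` ends: without a grey root neither `up` nor `Delete` nor `set_flag`
applies, and the failure of `set_flag` is the failure of `Reduce`. The bound is 603 for `up!`, 603
for the undone `Delete`, and 301 for `set_flag`. -/
theorem Reduce_runs_stopped {G : HostGraph} (hG : Stopped G) :
    Runs Reduce G 1507 fun γ t => γ = .fail ∧ t ≤ 1507 := by
  obtain ⟨u, hu⟩ := hG.root_unique
  refine Runs.seq (Mid := fun γ t => γ = .graph G ∧ t ≤ 603) ?_ (by simp) (by simp) ?_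
  · refine (Runs.alap (c := 301) (b := 603) (Body := fun γ t => γ = .fail ∧ t ≤ 301)
      (Runs.call (fun t H h => ?_) fun t h => ?_) (by omega) (by simp) (fun t h => ?_)
      (by simp)).mono (by omega) fun _ _ h => h
    · exact absurd h (not_applies_of_call fun r hr => by
        rw [List.mem_singleton.1 hr]; exact hG.not_applies (by decide))
    · have := hG.up_time h
      exact ⟨by omega, rfl, by omega⟩
    · exact ⟨by omega, rfl, by omega⟩
  · rintro H t ⟨hH, ht⟩
    cases hH
    refine ⟨904, by omega, Runs.tryElse (c := 301) (Cond := fun γ t => γ = .fail ∧ t ≤ 301)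
      (Runs.call (fun t H h => ?_) fun t h => ?_) (by omega) (by simp) (by simp) fun s hs => ?_⟩
    · exact absurd h (not_applies_of_call hG.not_Delete)
    · have := Delete_time hu h
      exact ⟨by omega, rfl, by omega⟩
    · refine ⟨301, by omega, Runs.call (fun t H h => ?_) fun t h => ?_⟩
      · exact absurd h (not_applies_of_call fun r hr => by
          rw [List.mem_singleton.1 hr]; exact hG.not_applies (by decide))
      · have := set_flag_time hu h
        exact ⟨by omega, rfl, by omega⟩

/-- `k` time units suffice to pay for the rest of the computation, up to a constant. -/
def Pays (k : ℕ) (G : HostGraph) : Prop :=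
  (Idle G ∧ 10000 * G.V.card + 302 * unmarkedEdges G ≤ k) ∨
  (∃ u, Active G u ∧ 10000 * G.V.card + 302 * unmarkedEdges G ≤ k + 8000) ∨
  ∃ u, Flagged G u

/-- By `Pays`, the budget of an active graph may fall 8000 short of the potential. The node of the
root still contributes 2000, enough for the constant cost of one pass. A deletion frees 10000: if a
root remains, the shortfall is kept; if the graph becomes idle, 8000 restore the full potential. If
`Delete` fails, `set_flag` succeeds, and a flagged graph needs no budget. -/
theorem Reduce_runs_active {G : HostGraph} {u k : ℕ} (hG : Active G u)
    (hk : 10000 * G.V.card + 302 * unmarkedEdges G ≤ k + 8000) :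
    Runs Reduce G k fun γ t => ∃ H k', γ = .graph H ∧ Pays k' H ∧ t + 1 + k' ≤ k := by
  have hpos : 0 < G.V.card := Finset.card_pos.2 ⟨u, hG.mem⟩
  refine Runs.seq ((upLoop_runs_active _ hG rfl).mono (by omega) fun _ _ h => h) (by simp)
    (by simp) ?_
  rintro G' t ⟨_, v, hH, hG', hV, ht⟩
  cases hH
  have hu : ∀ w ∈ G'.V, G'.root w = true → w = v := fun w hw => (hG'.root w hw).1
  refine ⟨904, by omega, Runs.tryElse (c := 301)
    (Cond := fun γ t => t ≤ 301 ∧ (γ = .fail ∨ ∃ H, γ = .graph H ∧ (Idle H ∨ ∃ v, Active H v) ∧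
      H.V.card + 1 = G'.V.card ∧ unmarkedEdges H ≤ unmarkedEdges G'))
    (Runs.call (fun t H h => ?_) fun t h => ?_) (by omega) (by simp) ?_ fun s hs => ?_⟩
  · have := Delete_time hu h
    obtain ⟨r, hr, h'⟩ := call_some_iff.1 ⟨t, h⟩
    exact ⟨by omega, by omega, .inr ⟨H, rfl, hG'.of_Delete hr h'⟩⟩
  · have := Delete_time hu h
    exact ⟨by omega, by omega, .inl rfl⟩
  · rintro H s ⟨hs, h | ⟨_, hH, h1, h2, h3⟩⟩
    · cases h
    cases hH
    refine ⟨1, by omega, Runs.skip ?_⟩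
    rw [hV] at h2
    rcases h1 with h1 | ⟨w, h1⟩
    · exact ⟨H, 10000 * H.V.card + 302 * unmarkedEdges H, rfl, .inl ⟨h1, le_rfl⟩, by omega⟩
    -- As `H` has a node, its potential is at least 10000 and the subtraction below is not
    -- truncated.
    · have := Finset.card_pos.2 ⟨w, h1.mem⟩
      exact ⟨H, 10000 * H.V.card + 302 * unmarkedEdges H - 8000, rfl,
        .inr (.inl ⟨w, h1, by omega⟩), by omega⟩
  · refine ⟨301, by omega, Runs.call (fun t' H h => ?_) fun t' h => ?_⟩
    · have := set_flag_time hu h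
      exact ⟨by omega, H, 0, rfl, .inr (.inr ⟨v, hG'.of_set_flag (applies_of_call h)⟩),
        by omega⟩
    · exact absurd h (not_call_none hG'.set_flag_applies)

/-- On an active graph, `t + 1 + k' ≤ k` makes the budget strictly smaller, so it serves as
induction measure. The extra 3015 = 2 · 1507 + 1 pays for the last `Reduce`, which fails and is
undone. -/
theorem reduceLoop_runs : ∀ (k : ℕ) {G : HostGraph}, Pays k G →
    Runs (.alap Reduce) G (k + 3015) fun γ t => ∃ H k', γ = .graph H ∧ Stopped H ∧ Pays k' H ∧
      t + k' ≤ k + 3015 := by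
  intro k
  induction k using Nat.strong_induction_on with
  | _ k ih =>
    intro G hG
    have stopped : Stopped G → Runs (.alap Reduce) G (k + 3015) fun γ t =>
        ∃ H k', γ = .graph H ∧ Stopped H ∧ Pays k' H ∧ t + k' ≤ k + 3015 := fun hs => by
      refine Runs.alap (Reduce_runs_stopped hs) (by omega) (by simp) (fun t h => ?_) (by simp)
      exact ⟨by omega, G, k, rfl, hs, hG, by omega⟩
    rcases hG with h | ⟨u, h, hk⟩ | h
    · exact stopped (.inl h.1)
    · refine Runs.alap (Reduce_runs_active h hk) (by omega) (by simp) (by simp) ?_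
      rintro H t ⟨_, k', hH, h1, h2⟩
      cases hH
      refine ⟨_, ?_, (ih k' (by omega) h1).mono le_rfl ?_⟩
      · omega
      · rintro γ s ⟨H', k'', rfl, h3, h4, h5⟩
        exact ⟨H', k'', rfl, h3, h4, by omega⟩
    · exact stopped (.inr h)

theorem Flagged.not_idle {G : HostGraph} {u : ℕ} (hG : Flagged G u) : ¬ Idle G := fun h => by
  have := (hG.root u hG.mem).2 rfl
  rw [h.root u hG.mem] at this
  cases this

theorem flagCond_runs_idle {G : HostGraph} (hG : Idle G) :
    Runs (.call [flag]) G 301 fun γ t => γ = .fail ∧ t ≤ 301 :=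
  Runs.call (fun _ _ h => absurd h (not_applies_of_call fun r hr => by
    rw [List.mem_singleton.1 hr]; exact hG.not_applies (by decide)))
    fun _ h => by have := flag_time hG.root_unique h; exact ⟨by omega, rfl, by omega⟩

theorem flagCond_runs_flagged {G : HostGraph} {u : ℕ} (hG : Flagged G u) :
    Runs (.call [flag]) G 301 fun γ t => (∃ H, γ = .graph H) ∧ t ≤ 301 :=
  Runs.call
    (fun _ H h => by
      have := flag_time (fun v hv => (hG.root v hv).1) h
      exact ⟨by omega, ⟨H, rfl⟩, by omega⟩)
    fun _ h => absurd h (not_call_none hG.flag_applies)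

/-- The bound consists of 2 · 301 + 1 for the undone test and one unit for `skip`. -/
theorem Guard_runs_idle {G : HostGraph} (hG : Idle G) :
    Runs Guard G 604 fun γ t => γ = .graph G ∧ t ≤ 604 :=
  Runs.ifElse (flagCond_runs_idle hG) (by omega) (by simp) (by simp)
    fun t ht => ⟨1, by omega, Runs.skip ⟨rfl, by omega⟩⟩

theorem Guard_runs_flagged {G : HostGraph} {u : ℕ} (hG : Flagged G u) :
    Runs Guard G 604 fun γ t => γ = .run .brk G ∧ t ≤ 604 :=
  Runs.ifElse (flagCond_runs_flagged hG) (by omega) (by simp)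
    (fun _ t ht => ⟨0, by omega, Runs.brk ⟨rfl, by omega⟩⟩) (by simp)

-- The main loop and the whole program

/-- The body of the main loop. -/
def Body : Com := .seq (.call [init]) (.seq (.alap Reduce) Guard)

/-- The pass borrows 8000 when the graph becomes active. This more than covers `init` (301), the
failing end of `Reduce!` (3015) and `Guard` (604). It is repaid when the deletion of the last root
makes the graph idle again; after a `break` no repayment is needed. -/
theorem Body_runs {G : HostGraph} {k : ℕ} (hG : Idle G) (hV : G.V.Nonempty)
    (hk : 10000 * G.V.card + 302 * unmarkedEdges G ≤ k) :
    Runs Body G k fun γ t =>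
      (∃ H k', γ = .graph H ∧ Idle H ∧ 10000 * H.V.card + 302 * unmarkedEdges H ≤ k' ∧
        t + 1 + k' ≤ k) ∨
      ∃ H u, γ = .run .brk H ∧ Flagged H u ∧ t + 1 ≤ k := by
  have hpos := Finset.card_pos.2 hV
  refine Runs.seq (Mid := fun γ t => t ≤ 301 ∧ ∃ H u, γ = .graph H ∧ Active H u ∧ H.V = G.V ∧
    unmarkedEdges H = unmarkedEdges G) ?_ (by simp) (by simp) ?_
  · refine Runs.call (fun t H h => ?_) fun t h => ?_
    · have := init_time (fun v hv => ⟨hG.grey v hv, hG.root v hv⟩) h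
      obtain ⟨u, hu⟩ := hG.of_init (applies_of_call h)
      exact ⟨by omega, by omega, H, u, rfl, hu⟩
    · exact absurd h (not_call_none (hG.init_applies hV.choose_spec))
  · rintro G' t ⟨ht, _, u, hH, hG', hV', hE'⟩
    cases hH
    have hpay : Pays (k - 8000) G' := .inr (.inl ⟨u, hG', by rw [hV', hE']; omega⟩)
    refine ⟨k - 301, by omega, Runs.seq ((reduceLoop_runs _ hpay).mono (by omega) fun _ _ h => h)
      (by simp) (by simp) ?_⟩
    rintro H s ⟨_, k', hH, hst, hk', hs⟩
    cases hH
    refine ⟨604, by omega, ?_⟩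
    rcases hst with hst | ⟨v, hst⟩
    · refine (Guard_runs_idle hst).mono le_rfl ?_
      rintro γ s' ⟨rfl, hs'⟩
      rcases hk' with ⟨-, hk'⟩ | ⟨v, hv, -⟩ | ⟨v, hv⟩
      · exact .inl ⟨H, k', rfl, hst, hk', by omega⟩
      · have := (hv.root v hv.mem).2 rfl
        rw [hst.root v hv.mem] at this
        cases this
      · exact absurd hst hv.not_idle
    · refine (Guard_runs_flagged hst).mono le_rfl ?_
      rintro γ s' ⟨rfl, hs'⟩
      exact .inr ⟨H, v, rfl, hst, by omega⟩

theorem Body_runs_empty {G : HostGraph} (hG : Idle G) (hV : G.V = ∅) :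
    Runs Body G 301 fun γ t => γ = .fail ∧ t ≤ 301 := by
  refine Runs.seq (Mid := fun γ t => γ = .fail ∧ t ≤ 301)
    (Runs.call (fun t H h => ?_) fun t h => ?_) (by simp) (fun t h => ⟨rfl, h.2⟩) (by simp)
  · obtain ⟨u, hu, hH, -⟩ := hG.of_init (applies_of_call h)
    have := hu.mem
    simp [hH, hV] at this
  · have := init_time (fun v hv => ⟨hG.grey v hv, hG.root v hv⟩) h
    exact ⟨by omega, rfl, by omega⟩

/-- On an idle graph with a node `init` succeeds, so the loop ends only on the empty graph or by
`break` on a flagged one. A pass that does neither returns an idle graph whose potential fits into a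
strictly smaller budget. -/
theorem mainLoop_runs : ∀ (k : ℕ) {G : HostGraph}, Idle G →
    10000 * G.V.card + 302 * unmarkedEdges G ≤ k →
    Runs (.alap Body) G (k + 603) fun γ t => ∃ H, γ = .graph H ∧ t ≤ k + 603 ∧
      (Idle H ∧ H.V = ∅ ∨ ∃ u, Flagged H u) := by
  intro k
  induction k using Nat.strong_induction_on with
  | _ k ih =>
    intro G hG hk
    rcases G.V.eq_empty_or_nonempty with hV | hV
    · refine Runs.alap (Body_runs_empty hG hV) (by omega) (by simp) (fun t h => ?_) (by simp)
      exact ⟨by omega, G, rfl, by omega, .inl ⟨hG, hV⟩⟩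
    · refine Runs.alap (Body_runs hG hV hk) (by omega) ?_ (by simp) ?_
      · rintro H t (⟨_, _, hH, -⟩ | ⟨_, u, hH, h1, h2⟩) <;> cases hH
        exact ⟨by omega, H, rfl, by omega, .inr ⟨u, h1⟩⟩
      · rintro H t (⟨_, k', hH, h1, h2, h3⟩ | ⟨_, u, hH, -⟩) <;> cases hH
        refine ⟨_, ?_, (ih k' (by omega) h1 h2).mono le_rfl ?_⟩
        · omega
        · rintro γ s ⟨H', rfl, h4, h5⟩
          exact ⟨H', rfl, by omega, h5⟩

theorem size_eq_zero {G : HostGraph} (hV : G.V = ∅) : G.size = 0 := by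
  have hE : G.E = ∅ := Finset.eq_empty_of_forall_notMem fun e he => by
    have := G.src_mem e he
    simp [hV] at this
  simp [HostGraph.size, hV, hE]

/-- `Check` turns flagged graphs into failure, so only the empty graph is ever written. The constant
is 603 for the last, failing pass of the main loop plus 604 for `Check`. -/
theorem Main_runs {G : HostGraph} (hG : Idle G) :
    Runs Main G (10000 * G.V.card + 302 * unmarkedEdges G + 1207) fun γ _ =>
      γ = .fail ∨ ∃ H, γ = .graph H ∧ H.size = 0 := by
  refine Runs.seq ((mainLoop_runs _ hG le_rfl).mono (by omega) fun _ _ h => h) (by simp)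
    (by simp) ?_
  rintro H t ⟨_, hH, ht, h | ⟨u, h⟩⟩ <;> cases hH
  · exact ⟨604, by omega, Runs.ifElse (flagCond_runs_idle h.1) (by omega) (by simp) (by simp)
      fun t ht => ⟨1, by omega, Runs.skip (.inr ⟨H, rfl, size_eq_zero h.2⟩)⟩⟩
  · exact ⟨604, by omega, Runs.ifElse (flagCond_runs_flagged h) (by omega) (by simp)
      (fun _ t ht => ⟨1, by omega, Runs.fail (.inl rfl)⟩) (by simp)⟩

theorem idle_of_isInput {G : HostGraph} (hG : G.IsInput) : Idle G where
  edge := fun e he => .inl (hG.unmarked e he)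
  grey := hG.grey
  root := hG.unrooted
  balance := fun v _ => by
    unfold dashedOut dashedIn
    congr 1
    refine Finset.filter_congr fun e he => ?_
    rw [hG.unmarked e he]
    simp

end IsBinDag

end GP2

/-- The program `is-bin-dag` terminates in time linear in the size of its input graph. -/
theorem mainTheorem6 :
    ∃ C : ℕ, ∀ G : GP2.HostGraph, G.IsInput →
      GP2.TerminatesWithin GP2.IsBinDag.Main G (C * (G.size + 1)) := by
  -- A node costs 10000 plus one unit for loading, an edge only 302 plus one, and the constant 1207
  -- is absorbed by the summand 1.
  refine ⟨10001, fun G hG =>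
    (GP2.IsBinDag.Main_runs (GP2.IsBinDag.idle_of_isInput hG)).terminatesWithin ?_ ?_ ?_⟩
  · have : GP2.IsBinDag.unmarkedEdges G ≤ G.E.card := Finset.card_filter_le _ _
    unfold GP2.HostGraph.size
    omega
  · rintro H t (h | ⟨_, h, -⟩) <;> cases h
  · rintro H t (h | ⟨_, h, h'⟩) <;> cases h
    exact h'
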